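/- Let $k$ be a field, let $d \ge 2$, and let $A = k[x_1,\dots,x_d]$ with its standard grading ($|x_i| = 1$), regarded also as a DG algebra with zero differential. A DG $A$-module is a $\mathbb{Z}$-graded $A$-module $M$ with an additive map $\partial$ of degree $-1$ such that $\partial^2 = 0$ and $\partial(am) = (-1)^{|a|}a\,\partial(m)$ for homogeneous $a \in A$. Let $D\,\mathrm{Gr}(A)$ be the derived category of complexes of $\mathbb{Z}$-graded $A$-modules and $D\,\mathrm{DG}(A)$ the derived category of DG $A$-modules (both obtained by inverting quasiisomorphisms). For a cochain complex $X$ of graded $A$-modules, with $X^i = \bigoplus_j X^i_j$, its totaling $\mathrm{Tot}\,X$ is the DG $A$-module $\bigoplus_{i} \Sigma^{-i} X^i$, so that $(\mathrm{Tot}\,X)_n = \bigoplus_i X^i_{n+i}$, with action $a\,(s^{-i}x^i)_i = (s^{-i}((-1)^{|a|i} a x^i))_i$ for homogeneous $a \in A$ and differential $(s^{-i}x^i)_i \mapsto (s^{-i-1}\partial_X x^i)_i$. Totaling preserves quasiisomorphisms and so induces a functor $\mathrm{Tot}\colon D\,\mathrm{Gr}(A) \to D\,\mathrm{DG}(A)$.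 Theorem. The functor $\mathrm{Tot}\colon D\,\mathrm{Gr}(A) \to D\,\mathrm{DG}(A)$ is not essentially surjective. More precisely, there is a semifree DG $A$-module $M$ of rank $4$ with semibasis $e_1, e_2, e_3, e_4$ in degrees $|e_1| = 0$, $|e_2| = 3$, $|e_3| = 4$, $|e_4| = 8$ and differential $$\partial e_1 = 0,\quad \partial e_2 = x_1x_2\,e_1,\quad \partial e_3 = x_2^3\,e_1,\quad \partial e_4 = x_1^7\,e_1 + x_2^4\,e_2 + x_1x_2^2\,e_3,$$ with the following properties. The homology $H(M)$ is indecomposable as a graded $A$-module. It has a minimal graded free resolution, and in every minimal graded free resolution $F_\bullet$ of $H(M)$ over $A$ the total Betti numbers satisfy $\sum_i \beta_i = \sum_i \operatorname{rank}_A F_i = 6$ (which differs from $4 = \operatorname{rank}_A M$). There is no complex $X$ of graded $A$-modules such that $M$ is quasiisomorphic (linked by a finite zigzag of quasiisomorphisms of DG $A$-modules) to $\mathrm{Tot}\,X$, and $M$ is not in the essential image of $\mathrm{Tot}\colon D\,\mathrm{Gr}(A) \to D\,\mathrm{DG}(A)$. -/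

import Mathlib

open CategoryTheory

universe u

noncomputable section

/-! ### Graded modules over a `ℤ`-graded algebra -/

/-- If the `ℳ j` generate `V` and any finite sum of elements of distinct `ℳ j` that vanishes has
vanishing terms, then `V` is the internal direct sum of the `ℳ j`. -/
theorem isInternal_of_sum_eq_zero {V : Type*} [AddCommGroup V] (ℳ : ℤ → AddSubgroup V)
    (hsup : ∀ x : V, x ∈ ⨆ j, ℳ j)
    (hind : ∀ (s : Finset ℤ) (f : ℤ → V), (∀ j, f j ∈ ℳ j) → ∑ j ∈ s, f j = 0 →
      ∀ j ∈ s, f j = 0) : DirectSum.IsInternal ℳ := by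
  classical
  constructor
  · rw [injective_iff_map_eq_zero]
    intro x hx
    ext j
    by_cases hj : j ∈ DFinsupp.support x
    · refine hind (DFinsupp.support x) (fun j => (x j : V)) (fun j => (x j).2) ?_ j hj
      rw [← hx]
      conv_rhs => rw [← DirectSum.sum_support_of x]
      simp [map_sum]
    · simpa using hj
  · intro x
    refine AddSubgroup.iSup_induction ℳ
      (C := fun x => ∃ a, DirectSum.coeAddMonoidHom ℳ a = x) (hsup x) ?_
      ⟨0, map_zero (DirectSum.coeAddMonoidHom ℳ)⟩ ?_
    · intro j y hy
      exact ⟨DirectSum.of (fun j => ℳ j) j ⟨y, hy⟩, by simp⟩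
    · rintro _ _ ⟨a, rfl⟩ ⟨b, rfl⟩
      exact ⟨a + b, map_add _ _ _⟩

section Graded

set_option linter.unusedSectionVars false
set_option linter.style.haveILetI false

variable {k A : Type u} [Field k] [CommRing A] [Algebra k A] (𝒜 : ℤ → Submodule k A)
  [GradedAlgebra 𝒜]

/-- A graded module over the graded algebra `A = ⨁ 𝒜 n`: an `A`-module that is the direct sum of
subgroups `deg j`, `j ∈ ℤ`, such that `𝒜 n • deg j ⊆ deg (n + j)`. -/
structure GrMod where
  carrier : Type u
  [addCommGroup : AddCommGroup carrier]
  [module : Module A carrier]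
  deg : ℤ → AddSubgroup carrier
  isInternal : DirectSum.IsInternal deg
  smul_mem : ∀ {n j : ℤ} {a : A} {x : carrier}, a ∈ 𝒜 n → x ∈ deg j → a • x ∈ deg (n + j)

attribute [instance] GrMod.addCommGroup GrMod.module

variable {𝒜}

namespace GrMod

/-- Morphisms of graded modules: `A`-linear maps of degree zero. -/
@[ext]
structure Hom (M N : GrMod 𝒜) where
  toLin : M.carrier →ₗ[A] N.carrier
  map_deg : ∀ {j : ℤ} {x : M.carrier}, x ∈ M.deg j → toLin x ∈ N.deg j

/-- The category `Gr(A)`. -/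
instance : Category (GrMod 𝒜) where
  Hom M N := Hom M N
  id M := ⟨LinearMap.id, fun h => h⟩
  comp f g := ⟨g.toLin ∘ₗ f.toLin, fun h => g.map_deg (f.map_deg h)⟩

instance : Limits.HasZeroMorphisms (GrMod 𝒜) where
  zero _ _ := ⟨⟨0, fun {_ _} _ => AddSubgroup.zero_mem _⟩⟩
  comp_zero _ _ := Hom.ext (LinearMap.zero_comp _)
  zero_comp _ {_ _} _ := Hom.ext (LinearMap.comp_zero _)

@[simp] theorem id_toLin (M : GrMod 𝒜) : Hom.toLin (𝟙 M) = LinearMap.id := rfl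

@[simp] theorem comp_toLin {M N P : GrMod 𝒜} (f : M ⟶ N) (g : N ⟶ P) :
    Hom.toLin (f ≫ g) = Hom.toLin g ∘ₗ Hom.toLin f := rfl

@[simp] theorem zero_toLin (M N : GrMod 𝒜) : Hom.toLin (0 : M ⟶ N) = 0 := rfl

theorem mem_iSup_deg (M : GrMod 𝒜) (x : M.carrier) : x ∈ ⨆ j, M.deg j := by
  classical
  obtain ⟨y, rfl⟩ := M.isInternal.2 x
  rw [← DirectSum.sum_support_of y, map_sum]
  refine AddSubgroup.sum_mem _ fun j _ => ?_
  simpa using (le_iSup M.deg j) (y j).2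

/-- The projection of a graded module onto its component of degree `j`. -/
def proj (M : GrMod 𝒜) (j : ℤ) : M.carrier →+ M.carrier :=
  letI := M.isInternal.chooseDecomposition
  { toFun := fun x => (DirectSum.decompose M.deg x j : M.carrier)
    map_zero' := by simp
    map_add' := fun x y => by simp }

theorem proj_mem (M : GrMod 𝒜) (j : ℤ) (x : M.carrier) : M.proj j x ∈ M.deg j := by
  letI := M.isInternal.chooseDecomposition
  exact (DirectSum.decompose M.deg x j).2

theorem proj_same (M : GrMod 𝒜) {j : ℤ} {x : M.carrier} (hx : x ∈ M.deg j) :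
    M.proj j x = x := by
  letI := M.isInternal.chooseDecomposition
  exact DirectSum.decompose_of_mem_same M.deg hx

theorem proj_ne (M : GrMod 𝒜) {i j : ℤ} {x : M.carrier} (hx : x ∈ M.deg i) (h : i ≠ j) :
    M.proj j x = 0 := by
  letI := M.isInternal.chooseDecomposition
  exact DirectSum.decompose_of_mem_ne M.deg hx h

theorem proj_sum (M : GrMod 𝒜) (s : Finset ℤ) (f : ℤ → M.carrier) (hf : ∀ j, f j ∈ M.deg j)
    {j : ℤ} (hj : j ∈ s) : M.proj j (∑ i ∈ s, f i) = f j := by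
  rw [map_sum, Finset.sum_eq_single j]
  · exact M.proj_same (hf j)
  · intro i _ hij
    exact M.proj_ne (hf i) hij
  · exact fun h => absurd hj h

theorem exists_sum_proj (M : GrMod 𝒜) (x : M.carrier) :
    ∃ s : Finset ℤ, x = ∑ j ∈ s, M.proj j x := by
  classical
  letI := M.isInternal.chooseDecomposition
  exact ⟨_, (DirectSum.sum_support_decompose M.deg x).symm⟩

end GrMod

/-! ### Signs, shifts, DG modules -/

variable (𝒜) in
/-- The ring endomorphism of `A` given by `a ↦ (-1)^(|a| i) a` on homogeneous elements. -/
def signTwist (i : ℤ) : A →+* A :=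
  (DirectSum.toSemiring
    (fun n => (((((n * i).negOnePow : ℤˣ) : ℤ) • (𝒜 n).subtype).toAddMonoidHom : 𝒜 n →+ A))
    (by simp)
    (by
      intro m n a b
      change (((m + n) * i).negOnePow : ℤ) • ((a : A) * (b : A)) =
        ((m * i).negOnePow : ℤ) • (a : A) * ((n * i).negOnePow : ℤ) • (b : A)
      rw [add_mul, Int.negOnePow_add, smul_mul_smul_comm, Units.val_mul])).comp
    (DirectSum.decomposeRingEquiv 𝒜).toRingHom

theorem signTwist_of_mem (i : ℤ) {n : ℤ} {a : A} (ha : a ∈ 𝒜 n) :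
    signTwist 𝒜 i a = (n * i).negOnePow • a := by
  have : DirectSum.decomposeRingEquiv 𝒜 a = DirectSum.of (fun n => 𝒜 n) n ⟨a, ha⟩ :=
    DirectSum.decompose_of_mem 𝒜 ha
  rw [signTwist, RingHom.comp_apply]
  exact (congrArg _ this).trans (DirectSum.toSemiring_of _ _ _ _ _)

theorem signTwist_signTwist (i : ℤ) (a : A) : signTwist 𝒜 i (signTwist 𝒜 i a) = a := by
  induction a using DirectSum.Decomposition.inductionOn 𝒜 with
  | zero => simp
  | homogeneous a =>
    rw [signTwist_of_mem i a.2, Units.smul_def, map_zsmul, signTwist_of_mem i a.2,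
      ← Units.smul_def, smul_smul]
    simp
  | add a b ha hb => rw [map_add, map_add, ha, hb]

/-- The shift `Σ^d M` of a graded module: `(Σ^d M)_j = M_{j - d}`, with the action
`a • s^d(x) = (-1)^(|a| d) s^d(a x)`. -/
def GrMod.shift (d : ℤ) (M : GrMod 𝒜) : GrMod 𝒜 where
  carrier := M.carrier
  module := Module.compHom M.carrier (signTwist 𝒜 d)
  deg j := M.deg (j - d)
  isInternal := by
    refine isInternal_of_sum_eq_zero _ ?_ ?_
    · intro x
      rw [show (⨆ j, M.deg (j - d)) = ⨆ j, M.deg j from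
        (Equiv.subRight d).surjective.iSup_comp M.deg]
      exact M.mem_iSup_deg x
    · intro s f hf h j hj
      rw [← M.proj_same (hf j), ← map_zero (M.proj (j - d)), ← h, map_sum,
        Finset.sum_eq_single j]
      · intro i _ hij
        exact M.proj_ne (hf i) (by omega)
      · exact fun h => absurd hj h
  smul_mem := by
    intro n j a x ha hx
    change signTwist 𝒜 d a • x ∈ _
    have h : a • x ∈ M.deg (n + j - d) := by
      rw [add_sub_assoc]; exact M.smul_mem ha hx
    rw [signTwist_of_mem d ha, smul_assoc, Units.smul_def]
    exact AddSubgroup.zsmul_mem _ h _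

variable (𝒜) in
/-- A DG module over `A`, where the graded algebra `A` is regarded as a DG algebra with zero
differential: a graded module with a differential of (homological) degree `-1` that satisfies the
Leibniz rule `∂(a x) = (-1)^|a| a ∂(x)`. -/
structure DGMod extends GrMod 𝒜 where
  d : carrier →+ carrier
  d_mem : ∀ {j : ℤ} {x : carrier}, x ∈ deg j → d x ∈ deg (j - 1)
  d_d : ∀ x : carrier, d (d x) = 0
  leibniz : ∀ {n : ℤ} {a : A}, a ∈ 𝒜 n → ∀ x : carrier, d (a • x) = n.negOnePow • a • d x

namespace DGMod

/-- Morphisms of DG modules: morphisms of graded modules that commute with the differentials. -/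
@[ext]
structure Hom (M N : DGMod 𝒜) extends GrMod.Hom M.toGrMod N.toGrMod where
  comm : ∀ x : M.carrier, toLin (M.d x) = N.d (toLin x)

/-- The category `DG(A)`. -/
instance : Category (DGMod 𝒜) where
  Hom M N := Hom M N
  id M := ⟨GrMod.Hom.mk LinearMap.id (fun h => h), fun _ => rfl⟩
  comp f g := ⟨GrMod.Hom.mk (g.toLin ∘ₗ f.toLin) (fun h => g.map_deg (f.map_deg h)), fun x => by
    simp [f.comm, g.comm]⟩

theorem d_smul (M : DGMod 𝒜) (a : A) (x : M.carrier) :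
    M.d (a • x) = signTwist 𝒜 1 a • M.d x := by
  induction a using DirectSum.Decomposition.inductionOn 𝒜 with
  | zero => simp
  | homogeneous a => rw [M.leibniz a.2, signTwist_of_mem 1 a.2, mul_one, smul_assoc]
  | add a b ha hb => rw [add_smul, map_add, ha, hb, map_add, add_smul]

theorem proj_d (M : DGMod 𝒜) (j : ℤ) (x : M.carrier) :
    M.proj j (M.d x) = M.d (M.proj (j + 1) x) := by
  obtain ⟨s, hs⟩ := M.exists_sum_proj x
  have key : ∀ i : ℤ, M.proj j (M.d (M.proj i x)) = M.d (M.proj (j + 1) (M.proj i x)) := by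
    intro i
    have hi := M.proj_mem i x
    by_cases h : i = j + 1
    · subst h
      have := M.d_mem hi
      rw [add_sub_cancel_right] at this
      rw [M.proj_same hi, M.proj_same this]
    · rw [M.proj_ne hi h, M.proj_ne (M.d_mem hi) (by omega), map_zero]
  rw [hs, map_sum, map_sum, map_sum, map_sum]
  exact Finset.sum_congr rfl fun i _ => key i

/-- The cycles `Z(M)`. -/
def cycles (M : DGMod 𝒜) : Submodule A M.carrier where
  carrier := {x | M.d x = 0}
  zero_mem' := map_zero M.d
  add_mem' {x y} hx hy := by
    simp only [Set.mem_ofPred_eq] at *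
    rw [map_add, hx, hy, add_zero]
  smul_mem' a x hx := by
    simp only [Set.mem_ofPred_eq] at *
    rw [d_smul, hx, smul_zero]

/-- The boundaries `B(M)`. -/
def boundaries (M : DGMod 𝒜) : Submodule A M.carrier where
  carrier := {x | ∃ y, M.d y = x}
  zero_mem' := ⟨0, map_zero M.d⟩
  add_mem' := by
    rintro _ _ ⟨x, rfl⟩ ⟨y, rfl⟩
    exact ⟨x + y, map_add _ _ _⟩
  smul_mem' := by
    rintro a _ ⟨x, rfl⟩
    exact ⟨signTwist 𝒜 1 a • x, by rw [d_smul, signTwist_signTwist]⟩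

/-- The homology `H(M) = Z(M) / B(M)`, a graded module; `H(M)_j` consists of the classes of the
cycles of degree `j`. -/
def homology (M : DGMod 𝒜) : GrMod 𝒜 where
  carrier := M.cycles ⧸ M.boundaries.submoduleOf M.cycles
  deg j := ((M.deg j).comap M.cycles.subtype.toAddMonoidHom).map
    (M.boundaries.submoduleOf M.cycles).mkQ.toAddMonoidHom
  isInternal := by
    have hz : ∀ (z : M.cycles) (j : ℤ), M.proj j z ∈ M.cycles := by
      rintro ⟨z, hz⟩ j
      change M.d z = 0 at hz
      change M.d (M.proj j z) = 0
      have := M.proj_d (j - 1) z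
      rw [sub_add_cancel] at this
      rw [← this, hz, map_zero]
    refine isInternal_of_sum_eq_zero _ ?_ ?_
    · intro x
      obtain ⟨z, rfl⟩ := Submodule.mkQ_surjective _ x
      obtain ⟨s, hs⟩ := M.exists_sum_proj (z : M.carrier)
      have hzs : z = ∑ j ∈ s, (⟨M.proj j z, hz z j⟩ : M.cycles) := by
        apply Subtype.ext
        rw [AddSubmonoidClass.coe_finsetSum]
        exact hs
      rw [hzs, map_sum]
      refine AddSubgroup.sum_mem _ fun j _ => ?_
      exact (le_iSup (fun j => ((M.deg j).comap M.cycles.subtype.toAddMonoidHom).map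
        (M.boundaries.submoduleOf M.cycles).mkQ.toAddMonoidHom) j)
        ⟨⟨M.proj j z, hz z j⟩, M.proj_mem j _, rfl⟩
    · intro s f hf h j hj
      choose g hg hgf using hf
      have hsum : (Submodule.mkQ (M.boundaries.submoduleOf M.cycles)) (∑ i ∈ s, g i) = 0 := by
        rw [map_sum, ← h]
        exact Finset.sum_congr rfl fun i _ => hgf i
      rw [Submodule.mkQ_apply, Submodule.Quotient.mk_eq_zero] at hsum
      obtain ⟨y, hy⟩ := hsum
      rw [Submodule.subtype_apply, AddSubmonoidClass.coe_finsetSum] at hy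
      rw [← hgf j]
      change Submodule.mkQ (M.boundaries.submoduleOf M.cycles) (g j) = 0
      rw [Submodule.mkQ_apply, Submodule.Quotient.mk_eq_zero]
      refine ⟨M.proj (j + 1) y, ?_⟩
      rw [← proj_d, hy]
      exact M.proj_sum s (fun i => (g i : M.carrier)) hg hj
  smul_mem := by
    rintro n j a _ ha ⟨z, hz, rfl⟩
    exact ⟨a • z, M.smul_mem ha hz, rfl⟩

/-- The map induced on homology by a morphism of DG modules. -/
def homologyMap {M N : DGMod 𝒜} (f : M ⟶ N) :
    M.homology.carrier →ₗ[A] N.homology.carrier :=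
  Submodule.mapQ (M.boundaries.submoduleOf M.cycles) (N.boundaries.submoduleOf N.cycles)
    (f.toLin.restrict (p := M.cycles) (q := N.cycles) (fun x hx => by
      change M.d x = 0 at hx
      change N.d (f.toLin x) = 0
      rw [← f.comm, hx, map_zero]))
    (by
      rintro ⟨_, hx⟩ ⟨y, rfl⟩
      exact ⟨f.toLin y, (f.comm y).symm⟩)

variable (𝒜) in
/-- The quasiisomorphisms of DG modules: the morphisms that induce a bijection on homology. -/
def quasiIso : MorphismProperty (DGMod 𝒜) :=
  fun _ _ f => Function.Bijective (homologyMap f)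

/-- Two DG modules are quasiisomorphic if they are linked by a finite zigzag of
quasiisomorphisms. -/
def QuasiIsomorphic (M N : DGMod 𝒜) : Prop :=
  Relation.EqvGen (fun M N : DGMod 𝒜 => ∃ f : M ⟶ N, quasiIso 𝒜 f) M N

/-- A homogeneous basis `b` of the graded module underlying `M` is a semibasis if it is the
disjoint union of subsets `E_0, E_1, …` (where `b i ∈ E_(level i)`) such that `∂(E_n)` lies in the
submodule generated by the `E_m` with `m < n`. -/
def IsSemibasis (M : DGMod 𝒜) {ι : Type*} (b : Module.Basis ι A M.carrier) : Prop :=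
  (∀ i, ∃ j, b i ∈ M.deg j) ∧
    ∃ level : ι → ℕ, ∀ i, M.d (b i) ∈ Submodule.span A (b '' {i' | level i' < level i})

end DGMod

/-! ### Complexes of graded modules and their derived category -/

/-- The cohomology `H^i(X)` of a cochain complex of graded modules (its underlying module). -/
abbrev GrMod.cohomology (X : CochainComplex (GrMod 𝒜) ℤ) (i : ℤ) : Type u :=
  LinearMap.ker (X.d i (i + 1)).toLin ⧸
    (LinearMap.range (X.d (i - 1) i).toLin).submoduleOf (LinearMap.ker (X.d i (i + 1)).toLin)

theorem GrMod.comm_apply {X Y : CochainComplex (GrMod 𝒜) ℤ} (f : X ⟶ Y) (i j : ℤ)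
    (x : (X.X i).carrier) :
    (Y.d i j).toLin ((f.f i).toLin x) = (f.f j).toLin ((X.d i j).toLin x) :=
  DFunLike.congr_fun (congrArg GrMod.Hom.toLin (f.comm i j)) x

/-- The map induced on cohomology by a morphism of complexes of graded modules. -/
def GrMod.cohomologyMap {X Y : CochainComplex (GrMod 𝒜) ℤ} (f : X ⟶ Y) (i : ℤ) :
    GrMod.cohomology X i →ₗ[A] GrMod.cohomology Y i :=
  Submodule.mapQ _ _
    ((f.f i).toLin.restrict (p := LinearMap.ker (X.d i (i + 1)).toLin)
      (q := LinearMap.ker (Y.d i (i + 1)).toLin) (fun x hx => by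
        rw [LinearMap.mem_ker] at hx ⊢
        rw [comm_apply, hx, map_zero]))
    (by
      rintro ⟨_, hx⟩ ⟨y, rfl⟩
      exact ⟨(f.f (i - 1)).toLin y, comm_apply f _ _ y⟩)

variable (𝒜) in
/-- The quasiisomorphisms of complexes of graded modules. -/
def GrMod.quasiIso : MorphismProperty (CochainComplex (GrMod 𝒜) ℤ) :=
  fun _ _ f => ∀ i, Function.Bijective (GrMod.cohomologyMap f i)

variable (𝒜) in
/-- The derived category `D Gr(A)`: complexes of graded modules, localized at the
quasiisomorphisms. -/
abbrev DerivedGr := (GrMod.quasiIso 𝒜).Localization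

variable (𝒜) in
/-- The derived category `D DG(A)`: DG modules, localized at the quasiisomorphisms. -/
abbrev DerivedDG := (DGMod.quasiIso 𝒜).Localization

/-! ### Totaling -/

open DirectSum

namespace Tot

/-- The underlying module `⨁ i, Σ^(-i) X^i` of the totaling. -/
abbrev Carrier (X : CochainComplex (GrMod 𝒜) ℤ) : Type u :=
  ⨁ i : ℤ, ((X.X i).shift (-i)).carrier

/-- The map `Σ^(-i) X^i → Σ^(-i-1) X^(i+1)`, `s^(-i) x ↦ s^(-i-1) d(x)`. -/
def shiftD (X : CochainComplex (GrMod 𝒜) ℤ) (i : ℤ) :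
    ((X.X i).shift (-i)).carrier →+ ((X.X (i + 1)).shift (-(i + 1))).carrier where
  toFun x := (X.d i (i + 1)).toLin x
  map_zero' := map_zero (X.d i (i + 1)).toLin
  map_add' := map_add (X.d i (i + 1)).toLin

/-- The differential of the totaling: `s^(-i) x ↦ s^(-i-1) d(x)` for `x ∈ X^i`. -/
def diff (X : CochainComplex (GrMod 𝒜) ℤ) : Carrier X →+ Carrier X :=
  DirectSum.toAddMonoid fun i =>
    (DirectSum.of (fun i => ((X.X i).shift (-i)).carrier) (i + 1)).comp (shiftD X i)

theorem diff_of (X : CochainComplex (GrMod 𝒜) ℤ) (i : ℤ) (x : ((X.X i).shift (-i)).carrier) :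
    diff X (DirectSum.of (fun i => ((X.X i).shift (-i)).carrier) i x) =
      DirectSum.of (fun i => ((X.X i).shift (-i)).carrier) (i + 1) (shiftD X i x) :=
  DirectSum.toAddMonoid_of _ _ _

theorem diff_apply (X : CochainComplex (GrMod 𝒜) ℤ) (x : Carrier X) (i : ℤ) :
    diff X x (i + 1) = shiftD X i (x i) := by
  induction x using DirectSum.induction_on with
  | zero => simp
  | of j y =>
    rw [diff_of]
    by_cases h : j = i
    · subst h
      rw [DirectSum.of_eq_same, DirectSum.of_eq_same]
    · rw [DirectSum.of_eq_of_ne _ _ _ (by omega), DirectSum.of_eq_of_ne _ _ _ (by omega),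
        map_zero]
  | add a b ha hb => rw [map_add, DirectSum.add_apply, DirectSum.add_apply, ha, hb, map_add]

theorem diff_diff (X : CochainComplex (GrMod 𝒜) ℤ) (x : Carrier X) : diff X (diff X x) = 0 := by
  induction x using DirectSum.induction_on with
  | zero => simp
  | of j y =>
    rw [diff_of, diff_of]
    have : shiftD X (j + 1) (shiftD X j y) = 0 :=
      DFunLike.congr_fun (congrArg GrMod.Hom.toLin (X.d_comp_d j (j + 1) (j + 1 + 1))) y
    rw [this, map_zero]
  | add a b ha hb => rw [map_add, map_add, ha, hb, add_zero]

theorem map_signTwist_smul {M N : GrMod 𝒜} (f : M ⟶ N) (i : ℤ) {n : ℤ} {a : A} (ha : a ∈ 𝒜 n)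
    (x : M.carrier) : f.toLin (signTwist 𝒜 (-i) a • x) =
      n.negOnePow • signTwist 𝒜 (-(i + 1)) a • f.toLin x := by
  rw [map_smul, signTwist_of_mem _ ha, signTwist_of_mem _ ha, smul_assoc, smul_assoc,
    smul_smul, ← Int.negOnePow_add]
  rw [show n + n * -(i + 1) = n * -i by ring]

/-- The totaling of a cochain complex `X` of graded modules, with underlying graded module
`⨁ i, Σ^(-i) X^i`. -/
def obj (X : CochainComplex (GrMod 𝒜) ℤ) : DGMod 𝒜 where
  carrier := Carrier X
  deg j :=
    { carrier := {x | ∀ i, x i ∈ ((X.X i).shift (-i)).deg j}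
      zero_mem' := fun i => AddSubgroup.zero_mem _
      add_mem' := fun hx hy i => AddSubgroup.add_mem _ (hx i) (hy i)
      neg_mem' := fun hx i => AddSubgroup.neg_mem _ (hx i) }
  isInternal := by
    refine isInternal_of_sum_eq_zero _ ?_ ?_
    · intro x
      induction x using DirectSum.induction_on with
      | zero => exact AddSubgroup.zero_mem _
      | of i y =>
        obtain ⟨s, hs⟩ := ((X.X i).shift (-i)).exists_sum_proj y
        rw [hs, map_sum]
        refine AddSubgroup.sum_mem _ fun j _ => AddSubgroup.mem_iSup_of_mem j ?_
        intro l
        by_cases h : i = l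
        · subst h
          rw [DirectSum.of_eq_same]
          exact GrMod.proj_mem _ _ _
        · rw [DirectSum.of_eq_of_ne _ _ _ (Ne.symm h)]
          exact AddSubgroup.zero_mem _
      | add a b ha hb => exact AddSubgroup.add_mem _ ha hb
    · intro s f hf h j hj
      ext i
      rw [← GrMod.proj_sum ((X.X i).shift (-i)) s (fun j => f j i) (fun j => hf j i) hj]
      have : ∑ j ∈ s, f j i = 0 := by
        rw [← DirectSum.sum_apply, h, DirectSum.zero_apply]
      rw [this, map_zero, DirectSum.zero_apply]
  smul_mem := by
    intro n j a x ha hx i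
    rw [DirectSum.smul_apply]
    exact GrMod.smul_mem _ ha (hx i)
  d := diff X
  d_mem := by
    intro j x hx i
    obtain ⟨i, rfl⟩ : ∃ l, i = l + 1 := ⟨i - 1, by omega⟩
    rw [diff_apply]
    have := (X.d i (i + 1)).map_deg (hx i)
    rw [show j - -i = j - 1 - -(i + 1) by omega] at this
    exact this
  d_d := diff_diff X
  leibniz := by
    intro n a ha x
    ext i
    obtain ⟨i, rfl⟩ : ∃ l, i = l + 1 := ⟨i - 1, by omega⟩
    have h1 : diff X (a • x) (i + 1) = shiftD X i (a • x i) := by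
      rw [diff_apply, DirectSum.smul_apply]
    have h2 : (n.negOnePow • a • diff X x) (i + 1) =
        n.negOnePow • a • shiftD X i (x i) := by
      rw [← diff_apply, Units.smul_def, Units.smul_def]
      rfl
    rw [h1, h2]
    exact map_signTwist_smul (X.d i (i + 1)) i ha (x i)

/-- The map of shifts induced by a map of graded modules. -/
def shiftMap {M N : GrMod 𝒜} (f : M ⟶ N) (d : ℤ) :
    (M.shift d).carrier →ₗ[A] (N.shift d).carrier where
  toFun x := f.toLin x
  map_add' := map_add f.toLin
  map_smul' a := map_smul f.toLin (signTwist 𝒜 d a)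

theorem map_comm {X Y : CochainComplex (GrMod 𝒜) ℤ} (f : X ⟶ Y) (x : Carrier X) (i : ℤ) :
    shiftMap (f.f (i + 1)) (-(i + 1)) (diff X x (i + 1)) =
      diff Y (DirectSum.lmap (fun i => shiftMap (f.f i) (-i)) x) (i + 1) := by
  rw [diff_apply, diff_apply]
  exact (GrMod.comm_apply f i (i + 1) (x i)).symm

/-- The morphism `(s^(-i) x^i) ↦ (s^(-i) f^i(x^i))`. -/
def map {X Y : CochainComplex (GrMod 𝒜) ℤ} (f : X ⟶ Y) : obj X ⟶ obj Y :=
  ⟨⟨DirectSum.lmap fun i => shiftMap (f.f i) (-i), fun hx i => (f.f i).map_deg (hx i)⟩, by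
    intro x
    refine DFinsupp.ext fun i => ?_
    obtain ⟨i, rfl⟩ : ∃ l, i = l + 1 := ⟨i - 1, by omega⟩
    exact map_comm f x i⟩

end Tot

variable (𝒜) in
/-- The totaling functor `Tot : Ch Gr(A) ⥤ DG(A)`. -/
def tot : CochainComplex (GrMod 𝒜) ℤ ⥤ DGMod 𝒜 where
  obj := Tot.obj
  map := Tot.map
  map_id X := by
    refine DGMod.Hom.ext (LinearMap.ext fun x => DFinsupp.ext fun i => rfl)
  map_comp f g := by
    refine DGMod.Hom.ext (LinearMap.ext fun x => DFinsupp.ext fun i => rfl)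

namespace DGMod

theorem bijective_homologyMap {M N : DGMod 𝒜} (f : M ⟶ N)
    (hinj : ∀ x, M.d x = 0 → (∃ y, N.d y = f.toLin x) → ∃ y, M.d y = x)
    (hsurj : ∀ x, N.d x = 0 → ∃ z y, M.d z = 0 ∧ x = f.toLin z + N.d y) :
    Function.Bijective (homologyMap f) := by
  constructor
  · rw [injective_iff_map_eq_zero]
    intro q hq
    obtain ⟨⟨x, hx⟩, rfl⟩ := Submodule.mkQ_surjective _ q
    refine (Submodule.Quotient.mk_eq_zero _).2 ?_
    exact hinj x hx ((Submodule.Quotient.mk_eq_zero _).1 hq)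
  · intro q
    obtain ⟨⟨x, hx⟩, rfl⟩ := Submodule.mkQ_surjective _ q
    obtain ⟨z, y, hz, rfl⟩ := hsurj x hx
    refine ⟨Submodule.mkQ _ ⟨z, hz⟩, ?_⟩
    refine (Submodule.Quotient.eq _).2 ⟨-y, ?_⟩
    change N.d (-y) = f.toLin z - (f.toLin z + N.d y)
    rw [map_neg]
    abel

end DGMod

/-- Totaling preserves quasiisomorphisms. -/
theorem tot_quasiIso {X Y : CochainComplex (GrMod 𝒜) ℤ} (f : X ⟶ Y)
    (hf : GrMod.quasiIso 𝒜 f) : DGMod.quasiIso 𝒜 ((tot 𝒜).map f) := by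
  classical
  have hinj : ∀ (i m : ℤ), i = m - 1 → ∀ x : (X.X m).carrier,
      (X.d m (m + 1)).toLin x = 0 → (∃ y, (Y.d i m).toLin y = (f.f m).toLin x) →
      ∃ y, (X.d i m).toLin y = x := by
    rintro i m rfl x hx hy
    have h0 := (injective_iff_map_eq_zero _).1 (hf m).1
      (Submodule.mkQ _ ⟨x, LinearMap.mem_ker.2 hx⟩)
      ((Submodule.Quotient.mk_eq_zero _).2 hy)
    exact (Submodule.Quotient.mk_eq_zero _).1 h0
  have hsurj : ∀ (i m : ℤ), i = m - 1 → ∀ x : (Y.X m).carrier,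
      (Y.d m (m + 1)).toLin x = 0 →
      ∃ z y, (X.d m (m + 1)).toLin z = 0 ∧ x = (f.f m).toLin z + (Y.d i m).toLin y := by
    rintro i m rfl x hx
    obtain ⟨q, hq⟩ := (hf m).2 (Submodule.mkQ _ ⟨x, LinearMap.mem_ker.2 hx⟩)
    obtain ⟨⟨z, hz⟩, rfl⟩ := Submodule.mkQ_surjective _ q
    obtain ⟨y, hy⟩ := (Submodule.Quotient.eq _).1 hq
    refine ⟨z, -y, LinearMap.mem_ker.1 hz, ?_⟩
    change (Y.d (m - 1) m).toLin y = (f.f m).toLin z - x at hy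
    rw [map_neg, hy]
    abel
  refine DGMod.bijective_homologyMap _ ?_ ?_
  · intro x hx hy
    change Tot.Carrier X at x
    change Tot.diff X x = 0 at hx
    obtain ⟨y, hy⟩ := hy
    change Tot.Carrier Y at y
    change Tot.diff Y y = DirectSum.lmap (fun i => Tot.shiftMap (f.f i) (-i)) x at hy
    change ∃ y, Tot.diff X y = x
    have key : ∀ i : ℤ, ∃ w, Tot.shiftD X i w = x (i + 1) := by
      intro i
      refine hinj i (i + 1) (by omega) (x (i + 1)) ?_ ⟨y i, ?_⟩
      · have := Tot.diff_apply X x (i + 1)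
        rw [hx] at this
        exact this.symm
      · have := Tot.diff_apply Y y i
        rw [hy] at this
        exact this.symm
    choose w hw using key
    refine ⟨∑ j ∈ DFinsupp.support x, DirectSum.of _ (j - 1) (w (j - 1)), ?_⟩
    rw [map_sum]
    conv_rhs => rw [← DirectSum.sum_support_of x]
    refine Finset.sum_congr rfl fun j _ => ?_
    obtain ⟨i, rfl⟩ : ∃ i, j = i + 1 := ⟨j - 1, by omega⟩
    rw [Tot.diff_of, hw]
    obtain ⟨l, hl⟩ : ∃ l, l = i + 1 - 1 := ⟨_, rfl⟩
    rw [← hl]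
    obtain rfl : l = i := by omega
    rfl
  · intro x hx
    change Tot.Carrier Y at x
    change Tot.diff Y x = 0 at hx
    change ∃ (z : Tot.Carrier X) (y : Tot.Carrier Y), Tot.diff X z = 0 ∧
      x = DirectSum.lmap (fun i => Tot.shiftMap (f.f i) (-i)) z + Tot.diff Y y
    have key : ∀ j : ℤ, ∃ (z : Tot.Carrier X) (y : Tot.Carrier Y), Tot.diff X z = 0 ∧
        DirectSum.of (fun i => ((Y.X i).shift (-i)).carrier) j (x j) =
          DirectSum.lmap (fun i => Tot.shiftMap (f.f i) (-i)) z + Tot.diff Y y := by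
      intro j
      obtain ⟨i, rfl⟩ : ∃ i, j = i + 1 := ⟨j - 1, by omega⟩
      obtain ⟨z, y, hz, hzy⟩ : ∃ (z : ((X.X (i + 1)).shift (-(i + 1))).carrier)
          (y : ((Y.X i).shift (-i)).carrier), Tot.shiftD X (i + 1) z = 0 ∧
            x (i + 1) = Tot.shiftMap (f.f (i + 1)) (-(i + 1)) z + Tot.shiftD Y i y :=
        hsurj i (i + 1) (by omega) (x (i + 1)) (by
        have := Tot.diff_apply Y x (i + 1)
        rw [hx] at this
        exact this.symm)
      refine ⟨DirectSum.of (fun i => ((X.X i).shift (-i)).carrier) (i + 1) z,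
        DirectSum.of (fun i => ((Y.X i).shift (-i)).carrier) i y, ?_, ?_⟩
      · rw [Tot.diff_of, hz, map_zero]
      · rw [Tot.diff_of, DirectSum.lmap_of, ← map_add, hzy]
    choose z y hz hzy using key
    refine ⟨∑ j ∈ DFinsupp.support x, z j, ∑ j ∈ DFinsupp.support x, y j, ?_, ?_⟩
    · rw [map_sum, Finset.sum_eq_zero fun j _ => hz j]
    · rw [map_sum, map_sum, ← Finset.sum_add_distrib]
      conv_lhs => rw [← DirectSum.sum_support_of x]
      exact Finset.sum_congr rfl fun j _ => hzy j

variable (𝒜) in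
/-- The functor `Tot : D Gr(A) ⥤ D DG(A)` of derived categories induced by totaling. -/
def derivedTot : DerivedGr 𝒜 ⥤ DerivedDG 𝒜 :=
  Localization.Construction.lift (tot 𝒜 ⋙ (DGMod.quasiIso 𝒜).Q) fun _ _ f hf =>
    Localization.inverts (DGMod.quasiIso 𝒜).Q (DGMod.quasiIso 𝒜) _ (tot_quasiIso f hf)

/-! ### Indecomposable graded modules and minimal graded free resolutions -/

namespace GrMod

/-- A graded module is indecomposable if it is nonzero and, whenever it is isomorphic to a direct
sum `P ⊕ Q` of graded modules, `P = 0` or `Q = 0`. -/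
def IsIndecomposable (N : GrMod 𝒜) : Prop :=
  Nontrivial N.carrier ∧ ∀ (P Q : GrMod 𝒜) (e : (P.carrier × Q.carrier) ≃ₗ[A] N.carrier),
    (∀ j, ∀ p ∈ P.deg j, ∀ q ∈ Q.deg j, e (p, q) ∈ N.deg j) →
      Subsingleton P.carrier ∨ Subsingleton Q.carrier

/-- A graded module is graded free if it has a basis of homogeneous elements. -/
def IsGradedFree (N : GrMod 𝒜) : Prop :=
  ∃ (ι : Type u) (b : Module.Basis ι A N.carrier), ∀ i, ∃ j, b i ∈ N.deg j

variable (𝒜) in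
/-- The ideal of `A` generated by the homogeneous elements of positive degree. -/
def irrelevantIdeal : Ideal A := Ideal.span {a | ∃ n : ℤ, 0 < n ∧ a ∈ 𝒜 n}

/-- A minimal graded free resolution `⋯ → F 2 → F 1 → F 0 → N → 0` of a graded module over a
nonnegatively graded algebra with `𝒜 0 = k`; minimality means that the differentials have image in
`𝔪 F`, where `𝔪` is the irrelevant ideal. -/
structure MinimalFreeResolution (N : GrMod 𝒜) where
  F : ℕ → GrMod 𝒜
  free : ∀ n, (F n).IsGradedFree
  d : ∀ n, F (n + 1) ⟶ F n
  ε : F 0 ⟶ N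
  ε_surjective : Function.Surjective ε.toLin
  exact_zero : Function.Exact (d 0).toLin ε.toLin
  exact_succ : ∀ n, Function.Exact (d (n + 1)).toLin (d n).toLin
  minimal : ∀ n, LinearMap.range (d n).toLin ≤
    irrelevantIdeal 𝒜 • (⊤ : Submodule A (F n).carrier)

/-- The sum of the total Betti numbers `β_n = rank (F n)` read off a minimal graded free
resolution. -/
def MinimalFreeResolution.bettiSum {N : GrMod 𝒜} (R : MinimalFreeResolution N) : Cardinal.{u} :=
  Cardinal.sum fun n : ℕ => Module.rank A (R.F n).carrier

end GrMod

end Graded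

/-! ### Polynomial rings -/

/-- The standard grading of `k[x_1, …, x_d]`, with every variable of degree `1`. -/
abbrev stdGrading (k : Type u) [Field k] (d : ℕ) : ℤ → Submodule k (MvPolynomial (Fin d) k) :=
  MvPolynomial.weightedHomogeneousSubmodule k (fun _ : Fin d => (1 : ℤ))

instance stdGradedAlgebra (k : Type u) [Field k] (d : ℕ) : GradedAlgebra (stdGrading k d) :=
  MvPolynomial.weightedGradedAlgebra k _

end

/-! The obstruction is a secondary operation on homology. If `u` is a cycle, `∂v₁ = a₁u`, `∂v₂ =
a₂u`, and `a₁, a₂, b₁, b₂` satisfy the signed relation that makes `b₁v₁ + b₂v₂` a cycle, its class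
is a Massey-type element of the homology (`DGMod.bracket`). Quasiisomorphisms carry the set of such
classes onto the corresponding set, so homology together with this set factors through the derived
category (`DGMod.exists_linearEquiv_of_derived_iso`).

A totaling has an extra grading, by the cohomological index, which `∂` raises by exactly one. Its
homology therefore splits by index, and if it has no nontrivial idempotents it lives in a single
index `s`. Up to a boundary, `u` then has no part of index `s + 1`, so after a correction the parts
of `v₁` and `v₂` of index `s` are themselves cycles. Hence every bracket lies in `b₁H + b₂H`
(`Tot.exists_eq_smul_add_smul_of_mem_bracket`).

For the given `M`, the homology is generated by `z₀ = [e₁]` in degree 0 and `z₁ = [x₂²e₂ + x₁e₃]` in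
degree 5, with relations `x₁x₂z₀`, `x₂³z₀` and `x₁⁷z₀ + x₂²z₁`. The last relation ties the
generators together and excludes idempotents (`rankFour_idempotentsTrivial`). By construction `z₁`
is a bracket with `b₁ = x₂²`, `b₂ = x₁`; being a minimal generator, it is not in `x₂²H + x₁H`
(`rankFourClassOne_ne`). So `M` is not isomorphic to a totaling in the derived category.

The presentation extends to a minimal resolution with ranks 2, 3, 1. A Schanuel-type argument,
stable equivalence of syzygies modulo the irrelevant ideal, transfers the sum 6 to every minimal
resolution. -/

noncomputable section

/-! ### Homology brackets as invariants of the derived category -/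

section GradedGeneralities

set_option linter.unusedSectionVars false

variable {k A : Type u} [Field k] [CommRing A] [Algebra k A] {𝒜 : ℤ → Submodule k A}
  [GradedAlgebra 𝒜]

namespace GrMod

/-- Additive maps preserving degrees commute with the projections onto the components. -/
theorem proj_map {M N : GrMod 𝒜} (f : M.carrier →+ N.carrier)
    (hf : ∀ j, ∀ x ∈ M.deg j, f x ∈ N.deg j) (j : ℤ) (x : M.carrier) :
    N.proj j (f x) = f (M.proj j x) := by
  obtain ⟨s, hs⟩ := M.exists_sum_proj x
  have key : ∀ i : ℤ, N.proj j (f (M.proj i x)) = f (M.proj j (M.proj i x)) := by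
    intro i
    have hi := M.proj_mem i x
    by_cases h : i = j
    · subst h
      rw [M.proj_same hi, N.proj_same (hf i _ hi)]
    · rw [M.proj_ne hi h, N.proj_ne (hf i _ hi) h, map_zero]
  rw [hs, map_sum, map_sum, map_sum, map_sum]
  exact Finset.sum_congr rfl fun i _ => key i

/-- An injective degree-preserving map reflects degrees. -/
theorem mem_deg_of_map_mem {M N : GrMod 𝒜} (f : M.carrier →+ N.carrier)
    (hf : ∀ j, ∀ x ∈ M.deg j, f x ∈ N.deg j) (hinj : Function.Injective f) {j : ℤ}
    {x : M.carrier} (hx : f x ∈ N.deg j) : x ∈ M.deg j := by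
  have h := proj_map f hf j x
  rw [N.proj_same hx] at h
  rw [hinj h]
  exact M.proj_mem j x

end GrMod

namespace DGMod

/-- The homology class of a cycle. -/
def homologyClass (M : DGMod 𝒜) (x : M.carrier) (hx : M.d x = 0) : M.homology.carrier :=
  Submodule.mkQ (M.boundaries.submoduleOf M.cycles) ⟨x, hx⟩

variable (M : DGMod 𝒜)

theorem exists_homologyClass (h : M.homology.carrier) :
    ∃ x hx, M.homologyClass x hx = h := by
  obtain ⟨⟨x, hx⟩, rfl⟩ := Submodule.mkQ_surjective _ h
  exact ⟨x, hx, rfl⟩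

theorem homologyClass_eq_zero {x : M.carrier} (hx : M.d x = 0) :
    M.homologyClass x hx = 0 ↔ ∃ y, M.d y = x :=
  Submodule.Quotient.mk_eq_zero _

theorem homologyClass_eq {x y : M.carrier} (hx : M.d x = 0) (hy : M.d y = 0) :
    M.homologyClass x hx = M.homologyClass y hy ↔ ∃ w, M.d w = x - y :=
  Submodule.Quotient.eq _

theorem homologyClass_congr {x y : M.carrier} (hx : M.d x = 0) (h : x = y) :
    M.homologyClass x hx = M.homologyClass y (h ▸ hx) := by
  subst h; rfl

theorem d_smul_cycle (a : A) {x : M.carrier} (hx : M.d x = 0) : M.d (a • x) = 0 := by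
  rw [d_smul, hx, smul_zero]

theorem d_add_cycle {x y : M.carrier} (hx : M.d x = 0) (hy : M.d y = 0) : M.d (x + y) = 0 := by
  rw [map_add, hx, hy, add_zero]

theorem homologyClass_add {x y : M.carrier} (hx : M.d x = 0) (hy : M.d y = 0) :
    M.homologyClass (x + y) (M.d_add_cycle hx hy) =
      M.homologyClass x hx + M.homologyClass y hy := rfl

theorem homologyClass_smul (a : A) {x : M.carrier} (hx : M.d x = 0) :
    M.homologyClass (a • x) (M.d_smul_cycle a hx) = a • M.homologyClass x hx := rfl

theorem homologyClass_mem_deg {x : M.carrier} (hx : M.d x = 0) {j : ℤ} (h : x ∈ M.deg j) :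
    M.homologyClass x hx ∈ M.homology.deg j :=
  ⟨⟨x, hx⟩, h, rfl⟩

theorem exists_of_mem_homology_deg {h : M.homology.carrier} {j : ℤ} (hh : h ∈ M.homology.deg j) :
    ∃ x hx, x ∈ M.deg j ∧ M.homologyClass x hx = h := by
  obtain ⟨⟨x, hx⟩, hj, rfl⟩ := hh
  exact ⟨x, hx, hj, rfl⟩

variable {M}

theorem d_map {N : DGMod 𝒜} (f : M ⟶ N) {x : M.carrier} (hx : M.d x = 0) :
    N.d (f.toLin x) = 0 := by
  rw [← f.comm, hx, map_zero]

theorem homologyMap_homologyClass {N : DGMod 𝒜} (f : M ⟶ N) {x : M.carrier} (hx : M.d x = 0) :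
    homologyMap f (M.homologyClass x hx) = N.homologyClass (f.toLin x) (d_map f hx) := rfl

theorem homologyMap_mem_deg {N : DGMod 𝒜} (f : M ⟶ N) {j : ℤ} {h : M.homology.carrier}
    (hh : h ∈ M.homology.deg j) : homologyMap f h ∈ N.homology.deg j := by
  obtain ⟨x, hx, hj, rfl⟩ := M.exists_of_mem_homology_deg hh
  exact N.homologyClass_mem_deg _ (f.map_deg hj)

/-- The homology classes of the elements `b₁ v₁ + b₂ v₂`, where `∂ v₁ = a₁ u` and `∂ v₂ = a₂ u`
for some cycle `u`. -/
def bracket (a₁ a₂ b₁ b₂ : A) (N : DGMod 𝒜) : Set N.homology.carrier :=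
  {h | ∃ u v₁ v₂, N.d u = 0 ∧ N.d v₁ = a₁ • u ∧ N.d v₂ = a₂ • u ∧
    ∃ hc : N.d (b₁ • v₁ + b₂ • v₂) = 0, h = N.homologyClass _ hc}

/-- The sign twist comes from moving `∂` past `b₁` and `b₂` in the Leibniz rule; the condition `hab`
is exactly the vanishing of the resulting coefficient of `u`. -/
theorem d_bracket {a₁ a₂ b₁ b₂ : A} (hab : signTwist 𝒜 1 b₁ * a₁ + signTwist 𝒜 1 b₂ * a₂ = 0)
    {N : DGMod 𝒜} {u v₁ v₂ : N.carrier} (h₁ : N.d v₁ = a₁ • u) (h₂ : N.d v₂ = a₂ • u) :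
    N.d (b₁ • v₁ + b₂ • v₂) = 0 := by
  rw [map_add, d_smul, d_smul, h₁, h₂, smul_smul, smul_smul, ← add_smul, hab, zero_smul]

theorem homologyClass_mem_bracket {a₁ a₂ b₁ b₂ : A}
    (hab : signTwist 𝒜 1 b₁ * a₁ + signTwist 𝒜 1 b₂ * a₂ = 0) {N : DGMod 𝒜}
    {u v₁ v₂ : N.carrier} (hu : N.d u = 0) (h₁ : N.d v₁ = a₁ • u) (h₂ : N.d v₂ = a₂ • u) :
    N.homologyClass _ (d_bracket hab h₁ h₂) ∈ N.bracket a₁ a₂ b₁ b₂ :=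
  ⟨u, v₁, v₂, hu, h₁, h₂, d_bracket hab h₁ h₂, rfl⟩

theorem homologyMap_mem_bracket (a₁ a₂ b₁ b₂ : A) {N : DGMod 𝒜} (f : M ⟶ N)
    {h : M.homology.carrier} (hh : h ∈ M.bracket a₁ a₂ b₁ b₂) :
    homologyMap f h ∈ N.bracket a₁ a₂ b₁ b₂ := by
  obtain ⟨u, v₁, v₂, hu, h₁, h₂, hc, rfl⟩ := hh
  have heq : f.toLin (b₁ • v₁ + b₂ • v₂) = b₁ • f.toLin v₁ + b₂ • f.toLin v₂ := by simp
  refine ⟨f.toLin u, f.toLin v₁, f.toLin v₂, d_map f hu, ?_, ?_, heq ▸ d_map f hc, ?_⟩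
  · rw [← f.comm, h₁, map_smul]
  · rw [← f.comm, h₂, map_smul]
  · rw [homologyMap_homologyClass]
    exact N.homologyClass_congr _ heq

/-! ### Lifting cycles and brackets along a quasiisomorphism -/

section QuasiIso

variable {N : DGMod 𝒜} {f : M ⟶ N} (hf : quasiIso 𝒜 f)

include hf

theorem exists_boundary_of_map {x : M.carrier} (hx : M.d x = 0) {y : N.carrier}
    (hy : N.d y = f.toLin x) : ∃ w, M.d w = x := by
  rw [← M.homologyClass_eq_zero hx]
  refine hf.1 ?_
  rw [map_zero, homologyMap_homologyClass, N.homologyClass_eq_zero]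
  exact ⟨y, hy⟩

theorem exists_cycle_lift {x : N.carrier} (hx : N.d x = 0) :
    ∃ z w, M.d z = 0 ∧ f.toLin z = x + N.d w := by
  obtain ⟨h, hh⟩ := hf.2 (N.homologyClass x hx)
  obtain ⟨z, hz, rfl⟩ := M.exists_homologyClass h
  rw [homologyMap_homologyClass, N.homologyClass_eq] at hh
  obtain ⟨w, hw⟩ := hh
  exact ⟨z, w, hz, by rw [hw]; abel⟩

/-- Lifting the equation `∂ v' = a u'` along a quasiisomorphism, up to homotopy. -/
theorem exists_lift_of_d_eq_smul (a : A) {u : M.carrier} (hu : M.d u = 0) {u' p v' : N.carrier}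
    (hup : f.toLin u = u' + N.d p) (hv : N.d v' = a • u') :
    ∃ v q, M.d v = a • u ∧ f.toLin v = v' + signTwist 𝒜 1 a • p + N.d q := by
  -- Since `f u` differs from `u'` by `∂p`, the element `v'` must be corrected by a multiple of `p`,
  -- twisted so that the Leibniz sign cancels.
  have hd : N.d (v' + signTwist 𝒜 1 a • p) = f.toLin (a • u) := by
    rw [map_add, hv, d_smul, signTwist_signTwist, map_smul, hup, smul_add]
  obtain ⟨v₀, hv₀⟩ := exists_boundary_of_map hf (M.d_smul_cycle a hu) hd
  -- The lift `v₀` found so far need not map to the corrected `v'`; the discrepancy is a cycle,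
  -- which lifts up to a boundary `∂q`.
  have hc : N.d (v' + signTwist 𝒜 1 a • p - f.toLin v₀) = 0 := by
    rw [map_sub, hd, ← f.comm, hv₀, sub_self]
  obtain ⟨c, q, hc, hcq⟩ := exists_cycle_lift hf hc
  refine ⟨v₀ + c, q, by rw [map_add, hc, add_zero, hv₀], ?_⟩
  rw [map_add, hcq]
  abel

/-- Lift `u'` first, then `v₁'` and `v₂'` over the same lift. The two corrections by `p` cancel in
the combination, because of the relation between the coefficients, and the corrections by `q₁`, `q₂`
contribute boundaries. -/
theorem exists_mem_bracket_map {a₁ a₂ b₁ b₂ : A}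
    (hab : signTwist 𝒜 1 b₁ * a₁ + signTwist 𝒜 1 b₂ * a₂ = 0) {h' : N.homology.carrier}
    (hh' : h' ∈ N.bracket a₁ a₂ b₁ b₂) :
    ∃ h ∈ M.bracket a₁ a₂ b₁ b₂, homologyMap f h = h' := by
  obtain ⟨u', v₁', v₂', hu', h₁', h₂', hc', rfl⟩ := hh'
  obtain ⟨u, p, hu, hup⟩ := exists_cycle_lift hf hu'
  obtain ⟨v₁, q₁, h₁, hq₁⟩ := exists_lift_of_d_eq_smul hf a₁ hu hup h₁'
  obtain ⟨v₂, q₂, h₂, hq₂⟩ := exists_lift_of_d_eq_smul hf a₂ hu hup h₂'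
  refine ⟨_, homologyClass_mem_bracket hab hu h₁ h₂, ?_⟩
  rw [homologyMap_homologyClass, N.homologyClass_eq]
  refine ⟨signTwist 𝒜 1 b₁ • q₁ + signTwist 𝒜 1 b₂ • q₂, ?_⟩
  -- The twist is an involution, so applying it to the relation moves it from the `b`'s to the
  -- `a`'s.
  have hab' : b₁ * signTwist 𝒜 1 a₁ + b₂ * signTwist 𝒜 1 a₂ = 0 := by
    have := congrArg (signTwist 𝒜 1) hab
    simpa [signTwist_signTwist] using this
  have hp : b₁ • signTwist 𝒜 1 a₁ • p + b₂ • signTwist 𝒜 1 a₂ • p = 0 := by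
    rw [smul_smul, smul_smul, ← add_smul, hab', zero_smul]
  have e : f.toLin (b₁ • v₁ + b₂ • v₂) - (b₁ • v₁' + b₂ • v₂') =
      (b₁ • signTwist 𝒜 1 a₁ • p + b₂ • signTwist 𝒜 1 a₂ • p) + (b₁ • N.d q₁ + b₂ • N.d q₂) := by
    rw [map_add, map_smul, map_smul, hq₁, hq₂]
    simp only [smul_add]
    abel
  rw [e, hp, zero_add, map_add, d_smul, d_smul, signTwist_signTwist, signTwist_signTwist]

end QuasiIso

end DGMod

variable (𝒜) in
/-- A graded module with a distinguished subset. -/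
structure GrModWithSet where
  toGrMod : GrMod 𝒜
  set : Set toGrMod.carrier

namespace GrModWithSet

/-- Morphisms of graded modules that map the distinguished subset into the distinguished
subset. -/
@[ext]
structure Hom (P Q : GrModWithSet 𝒜) extends GrMod.Hom P.toGrMod Q.toGrMod where
  map_set : ∀ x ∈ P.set, toLin x ∈ Q.set

instance : Category (GrModWithSet 𝒜) where
  Hom P Q := Hom P Q
  id P := ⟨GrMod.Hom.mk LinearMap.id (fun h => h), fun _ hx => hx⟩
  comp f g := ⟨GrMod.Hom.mk (g.toLin ∘ₗ f.toLin) (fun h => g.map_deg (f.map_deg h)),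
    fun x hx => g.map_set _ (f.map_set x hx)⟩

theorem comp_toLin_apply {P Q R : GrModWithSet 𝒜} (f : P ⟶ Q) (g : Q ⟶ R)
    (x : P.toGrMod.carrier) : (f ≫ g).toLin x = g.toLin (f.toLin x) := rfl

theorem id_toLin_apply (P : GrModWithSet 𝒜) (x : P.toGrMod.carrier) :
    (𝟙 P : P ⟶ P).toLin x = x := rfl

/-- Bijectivity alone does not make the inverse a morphism: it respects degrees because an injective
graded map reflects them, and it respects the subsets because `hset` makes the map of subsets
surjective. -/
theorem isIso_of_bijective {P Q : GrModWithSet 𝒜} (f : P ⟶ Q) (hf : Function.Bijective f.toLin)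
    (hset : ∀ y ∈ Q.set, ∃ x ∈ P.set, f.toLin x = y) : IsIso f := by
  let e := LinearEquiv.ofBijective f.toLin hf
  have he : ∀ y, f.toLin (e.symm y) = y := e.apply_symm_apply
  let g : Q ⟶ P := Hom.mk (GrMod.Hom.mk e.symm.toLinearMap (fun {j y} hy => by
      refine GrMod.mem_deg_of_map_mem f.toLin.toAddMonoidHom (fun _ _ h => f.map_deg h) hf.1 ?_
      change f.toLin (e.symm y) ∈ _
      rwa [he]))
    (fun y hy => by
      obtain ⟨x, hx, rfl⟩ := hset y hy
      change e.symm (e x) ∈ _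
      rwa [e.symm_apply_apply])
  refine ⟨g, ?_, ?_⟩
  · exact Hom.ext (LinearMap.ext fun x => e.symm_apply_apply x)
  · exact Hom.ext (LinearMap.ext fun x => e.apply_symm_apply x)

theorem bijective_toLin_of_iso {P Q : GrModWithSet 𝒜} (f : P ≅ Q) :
    Function.Bijective f.hom.toLin := by
  refine Function.bijective_iff_has_inverse.2 ⟨f.inv.toLin, fun x => ?_, fun x => ?_⟩
  · rw [← comp_toLin_apply, f.hom_inv_id, id_toLin_apply]
  · rw [← comp_toLin_apply, f.inv_hom_id, id_toLin_apply]

end GrModWithSet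

namespace DGMod

variable (𝒜) in
/-- The functor sending a DG module to its homology, with the subset `bracket` distinguished. -/
def homologyWithBracket (a₁ a₂ b₁ b₂ : A) : DGMod 𝒜 ⥤ GrModWithSet 𝒜 where
  obj M := ⟨M.homology, M.bracket a₁ a₂ b₁ b₂⟩
  map f := GrModWithSet.Hom.mk (GrMod.Hom.mk (homologyMap f) (homologyMap_mem_deg f))
    (fun _ hh => homologyMap_mem_bracket a₁ a₂ b₁ b₂ f hh)
  map_id M := by
    refine GrModWithSet.Hom.ext (LinearMap.ext fun h => ?_)
    obtain ⟨x, hx, rfl⟩ := M.exists_homologyClass h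
    rfl
  map_comp {M _ _} f g := by
    refine GrModWithSet.Hom.ext (LinearMap.ext fun h => ?_)
    obtain ⟨x, hx, rfl⟩ := M.exists_homologyClass h
    rfl

/-- An isomorphism in the derived category of DG modules induces an isomorphism of graded modules
in homology that maps brackets to brackets. -/
theorem exists_linearEquiv_of_derived_iso {a₁ a₂ b₁ b₂ : A}
    (hab : signTwist 𝒜 1 b₁ * a₁ + signTwist 𝒜 1 b₂ * a₂ = 0) {M N : DGMod 𝒜}
    (i : (quasiIso 𝒜).Q.obj M ≅ (quasiIso 𝒜).Q.obj N) :
    ∃ θ : M.homology.carrier ≃ₗ[A] N.homology.carrier,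
      (∀ j, ∀ h ∈ M.homology.deg j, θ h ∈ N.homology.deg j) ∧
      ∀ h ∈ M.bracket a₁ a₂ b₁ b₂, θ h ∈ N.bracket a₁ a₂ b₁ b₂ := by
  have hinv : (quasiIso 𝒜).IsInvertedBy (homologyWithBracket 𝒜 a₁ a₂ b₁ b₂) := by
    intro M N f hf
    exact GrModWithSet.isIso_of_bijective ((homologyWithBracket 𝒜 a₁ a₂ b₁ b₂).map f) hf
      fun _ hy => exists_mem_bracket_map hf hab hy
  let F := Localization.Construction.lift _ hinv
  -- The factorization through the localization is an equality of functors, so it yields the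
  -- comparison isomorphisms needed at `M` and `N`.
  have hF : (quasiIso 𝒜).Q ⋙ F = homologyWithBracket 𝒜 a₁ a₂ b₁ b₂ :=
    Localization.Construction.fac _ hinv
  let φ : (homologyWithBracket 𝒜 a₁ a₂ b₁ b₂).obj M ≅ (homologyWithBracket 𝒜 a₁ a₂ b₁ b₂).obj N :=
    (eqToIso hF).symm.app M ≪≫ F.mapIso i ≪≫ (eqToIso hF).app N
  exact ⟨LinearEquiv.ofBijective φ.hom.toLin (GrModWithSet.bijective_toLin_of_iso φ),
    fun _ _ hh => φ.hom.map_deg hh, fun _ hh => φ.hom.map_set _ hh⟩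

theorem QuasiIsomorphic.nonempty_iso {M N : DGMod 𝒜} (h : QuasiIsomorphic M N) :
    Nonempty ((quasiIso 𝒜).Q.obj M ≅ (quasiIso 𝒜).Q.obj N) := by
  induction h with
  | rel M N h =>
    obtain ⟨f, hf⟩ := h
    have := (quasiIso 𝒜).Q_inverts f hf
    exact ⟨asIso ((quasiIso 𝒜).Q.map f)⟩
  | refl M => exact ⟨Iso.refl _⟩
  | symm _ _ _ h => exact ⟨h.some.symm⟩
  | trans _ _ _ _ _ h h' => exact ⟨h.some ≪≫ h'.some⟩

end DGMod

end GradedGeneralities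

/-! ### Uniqueness of Betti numbers through stable equivalence modulo an ideal -/

section MinimalResolutions

set_option linter.unusedSectionVars false

variable {A : Type u} [CommRing A] (I : Ideal A)

/-- An endomorphism is null modulo `I` if it factors through a linear map into `I P`, where `P` is
projective. -/
def NullModulo {N : Type u} [AddCommGroup N] [Module A N] (φ : N →ₗ[A] N) : Prop :=
  ∃ (P : Type u) (_ : AddCommGroup P) (_ : Module A P) (_ : Module.Projective A P)
    (α : N →ₗ[A] P) (β : P →ₗ[A] N), (∀ x, α x ∈ I • (⊤ : Submodule A P)) ∧ φ = β ∘ₗ α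

/-- Two modules are stably equivalent modulo `I` if there are maps between them that are mutually
inverse up to endomorphisms that are null modulo `I`. -/
def StablyEquivModulo (N N' : Type u) [AddCommGroup N] [Module A N] [AddCommGroup N']
    [Module A N'] : Prop :=
  ∃ (a : N →ₗ[A] N') (b : N' →ₗ[A] N),
    NullModulo I (b ∘ₗ a - LinearMap.id) ∧ NullModulo I (a ∘ₗ b - LinearMap.id)

variable {I}

theorem map_mem_smul_top {N N' : Type u} [AddCommGroup N] [Module A N] [AddCommGroup N']
    [Module A N'] (f : N →ₗ[A] N') {x : N} (hx : x ∈ I • (⊤ : Submodule A N)) :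
    f x ∈ I • (⊤ : Submodule A N') := by
  have := Submodule.mem_map_of_mem (f := f) hx
  rw [Submodule.map_smul''] at this
  exact Submodule.smul_mono le_rfl le_top this

/-- This is why the factorization is required to land in `I P`: null endomorphisms then vanish on `N
/ I N`, so stable equivalence induces an isomorphism there. -/
theorem NullModulo.mem_smul_top {N : Type u} [AddCommGroup N] [Module A N] {φ : N →ₗ[A] N}
    (h : NullModulo I φ) (x : N) : φ x ∈ I • (⊤ : Submodule A N) := by
  obtain ⟨P, _, _, _, α, β, hα, rfl⟩ := h
  exact map_mem_smul_top β (hα x)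

variable (I) in
theorem StablyEquivModulo.refl (N : Type u) [AddCommGroup N] [Module A N] :
    StablyEquivModulo I N N :=
  ⟨LinearMap.id, LinearMap.id,
    -- The difference is the zero map, which factors through the zero module.
    ⟨PUnit, inferInstance, inferInstance, inferInstance, 0, 0,
      fun _ => Submodule.zero_mem _, by ext; simp⟩,
    ⟨PUnit, inferInstance, inferInstance, inferInstance, 0, 0,
      fun _ => Submodule.zero_mem _, by ext; simp⟩⟩

theorem StablyEquivModulo.congr {N N' L L' : Type u} [AddCommGroup N] [Module A N]
    [AddCommGroup N'] [Module A N'] [AddCommGroup L] [Module A L] [AddCommGroup L'] [Module A L']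
    (h : StablyEquivModulo I N N') (e : N ≃ₗ[A] L) (e' : N' ≃ₗ[A] L') :
    StablyEquivModulo I L L' := by
  obtain ⟨a, b, ⟨P, _, _, _, α, β, hα, h₁⟩, ⟨P', _, _, _, α', β', hα', h₂⟩⟩ := h
  refine ⟨e'.toLinearMap ∘ₗ a ∘ₗ e.symm.toLinearMap, e.toLinearMap ∘ₗ b ∘ₗ e'.symm.toLinearMap,
    ⟨P, _, _, inferInstance, α ∘ₗ e.symm.toLinearMap, e.toLinearMap ∘ₗ β, fun x => hα _, ?_⟩,
    ⟨P', _, _, inferInstance, α' ∘ₗ e'.symm.toLinearMap, e'.toLinearMap ∘ₗ β', fun x => hα' _, ?_⟩⟩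
  · ext x
    have := congrArg e (LinearMap.congr_fun h₁ (e.symm x))
    simpa using this
  · ext x
    have := congrArg e' (LinearMap.congr_fun h₂ (e'.symm x))
    simpa using this

/-- Stably equivalent modules become isomorphic modulo `I`. -/
theorem StablyEquivModulo.nonempty_quotient_equiv {N N' : Type u} [AddCommGroup N] [Module A N]
    [AddCommGroup N'] [Module A N'] (h : StablyEquivModulo I N N') :
    Nonempty ((N ⧸ I • (⊤ : Submodule A N)) ≃ₗ[A] (N' ⧸ I • (⊤ : Submodule A N'))) := by
  obtain ⟨a, b, h₁, h₂⟩ := h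
  refine ⟨LinearEquiv.ofLinearMap
    (Submodule.mapQ _ _ a fun x hx => map_mem_smul_top a hx)
    (Submodule.mapQ _ _ b fun x hx => map_mem_smul_top b hx) ?_ ?_⟩
  · refine LinearMap.ext fun q => ?_
    obtain ⟨x, rfl⟩ := Submodule.mkQ_surjective _ q
    exact (Submodule.Quotient.eq _).2 (h₂.mem_smul_top x)
  · refine LinearMap.ext fun q => ?_
    obtain ⟨x, rfl⟩ := Submodule.mkQ_surjective _ q
    exact (Submodule.Quotient.eq _).2 (h₁.mem_smul_top x)

section Syzygy

variable {N F : Type u} [AddCommGroup N] [Module A N] [AddCommGroup F] [Module A F]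
  [Module.Projective A F] {p : F →ₗ[A] N}

/-- Subtracting from `ψ` a lift of the factorization of `φ` gives a map `F → ker p`. The subtracted
term factors through `p` and so dies on `ker p`; thus `χ` factors through the inclusion `ker p → F`,
whose image lies in `I F` by minimality. -/
theorem NullModulo.ker (hp : Function.Surjective p)
    (hK : LinearMap.ker p ≤ I • (⊤ : Submodule A F)) {φ : N →ₗ[A] N} (hφ : NullModulo I φ)
    (ψ : F →ₗ[A] F) (hψ : p ∘ₗ ψ = φ ∘ₗ p)
    (χ : LinearMap.ker p →ₗ[A] LinearMap.ker p) (hχ : ∀ x, (χ x : F) = ψ x) :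
    NullModulo I χ := by
  obtain ⟨P, _, _, _, α, β, -, rfl⟩ := hφ
  obtain ⟨β', hβ'⟩ := Module.projective_lifting_property p β hp
  let h : F →ₗ[A] LinearMap.ker p := LinearMap.codRestrict _ (ψ - β' ∘ₗ α ∘ₗ p) fun x => by
    have h₁ := LinearMap.congr_fun hψ x
    have h₂ := LinearMap.congr_fun hβ' (α (p x))
    simp only [LinearMap.comp_apply] at h₁ h₂
    simp [h₁, h₂]
  refine ⟨F, _, _, inferInstance, (LinearMap.ker p).subtype, h, fun x => hK x.2, ?_⟩
  ext x
  have : p x = 0 := x.2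
  simp [h, hχ, this]

variable {N' F' : Type u} [AddCommGroup N'] [Module A N'] [AddCommGroup F'] [Module A F']
  [Module.Projective A F'] {p' : F' →ₗ[A] N'}

/-- Stable equivalence passes to kernels of minimal projective covers. -/
theorem StablyEquivModulo.ker (h : StablyEquivModulo I N N') (hp : Function.Surjective p)
    (hK : LinearMap.ker p ≤ I • (⊤ : Submodule A F)) (hp' : Function.Surjective p')
    (hK' : LinearMap.ker p' ≤ I • (⊤ : Submodule A F')) :
    StablyEquivModulo I (LinearMap.ker p) (LinearMap.ker p') := by
  obtain ⟨a, b, h₁, h₂⟩ := h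
  obtain ⟨f, hf⟩ := Module.projective_lifting_property p' (a ∘ₗ p) hp'
  obtain ⟨g, hg⟩ := Module.projective_lifting_property p (b ∘ₗ p') hp
  have hf' : ∀ x, p' (f x) = a (p x) := fun x => LinearMap.congr_fun hf x
  have hg' : ∀ x, p (g x) = b (p' x) := fun x => LinearMap.congr_fun hg x
  refine ⟨f.restrict fun x hx => ?_, g.restrict fun x hx => ?_,
    NullModulo.ker hp hK h₁ (g ∘ₗ f - LinearMap.id) ?_ _ fun x => ?_,
    NullModulo.ker hp' hK' h₂ (f ∘ₗ g - LinearMap.id) ?_ _ fun x => ?_⟩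
  · rw [LinearMap.mem_ker] at hx ⊢
    rw [hf', hx, map_zero]
  · rw [LinearMap.mem_ker] at hx ⊢
    rw [hg', hx, map_zero]
  · ext x
    simp [hf', hg']
  · simp
  · ext x
    simp [hf', hg']
  · simp

/-- An element mapping into `I N = p(I F)` differs from an element of `I F` by an element of the
kernel, which already lies in `I F`. -/
theorem quotient_equiv_of_ker_le (hp : Function.Surjective p)
    (hK : LinearMap.ker p ≤ I • (⊤ : Submodule A F)) :
    Nonempty ((F ⧸ I • (⊤ : Submodule A F)) ≃ₗ[A] (N ⧸ I • (⊤ : Submodule A N))) := by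
  refine ⟨LinearEquiv.ofBijective
    (Submodule.mapQ _ _ p fun x hx => map_mem_smul_top p hx) ⟨?_, ?_⟩⟩
  · rw [← LinearMap.ker_eq_bot, Submodule.ker_mapQ, eq_bot_iff, Submodule.map_le_iff_le_comap]
    intro x hx
    rw [Submodule.comap_bot, Submodule.ker_mkQ]
    have hmap : (I • (⊤ : Submodule A F)).map p = I • (⊤ : Submodule A N) := by
      rw [Submodule.map_smul'', Submodule.map_top, LinearMap.range_eq_top.2 hp]
    rw [Submodule.mem_comap, ← hmap] at hx
    obtain ⟨y, hy, hyx⟩ := hx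
    have := hK (show x - y ∈ LinearMap.ker p by rw [LinearMap.mem_ker, map_sub, hyx, sub_self])
    simpa using Submodule.add_mem _ this hy
  · intro q
    obtain ⟨x, rfl⟩ := Submodule.mkQ_surjective _ q
    obtain ⟨y, rfl⟩ := hp x
    exact ⟨Submodule.mkQ _ y, rfl⟩

end Syzygy

/-- `F / I F` is the base change of `F` to the nonzero commutative ring `A / I`, where the rank of a
free module is the same cardinal. No finiteness is required. -/
theorem rank_eq_of_quotient_equiv (hI : I ≠ ⊤) {F F' : Type u} [AddCommGroup F] [Module A F]
    [Module.Free A F] [AddCommGroup F'] [Module A F'] [Module.Free A F']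
    (e : (F ⧸ I • (⊤ : Submodule A F)) ≃ₗ[A] (F' ⧸ I • (⊤ : Submodule A F'))) :
    Module.rank A F = Module.rank A F' := by
  have : Nontrivial (A ⧸ I) := Ideal.Quotient.nontrivial_iff.2 hI
  have : Nontrivial A := (Ideal.Quotient.mk I).domain_nontrivial
  let e' : TensorProduct A (A ⧸ I) F ≃ₗ[A] TensorProduct A (A ⧸ I) F' :=
    TensorProduct.quotTensorEquivQuotSMul F I ≪≫ₗ e ≪≫ₗ
      (TensorProduct.quotTensorEquivQuotSMul F' I).symm
  have h := (LinearEquiv.extendScalarsOfSurjective (S := A ⧸ I)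
    Ideal.Quotient.mk_surjective e').rank_eq
  rw [Module.rank_baseChange, Module.rank_baseChange, Cardinal.lift_id, Cardinal.lift_id] at h
  exact h

section Resolution

variable {k : Type u} [Field k] [Algebra k A] {𝒜 : ℤ → Submodule k A} [GradedAlgebra 𝒜]

namespace GrMod.MinimalFreeResolution

variable {N : GrMod 𝒜}

theorem free_F (R : MinimalFreeResolution N) (n : ℕ) : Module.Free A (R.F n).carrier := by
  obtain ⟨ι, b, -⟩ := R.free n
  exact Module.Free.of_basis b

/-- Exactness makes each image the syzygy of the previous one, so the stable comparison can be
iterated along the resolution. -/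
theorem ker_rangeRestrict_d (R : MinimalFreeResolution N) (n : ℕ) :
    LinearMap.ker (R.d n).toLin.rangeRestrict = LinearMap.range (R.d (n + 1)).toLin := by
  rw [LinearMap.ker_rangeRestrict]
  exact (R.exact_succ n).linearMap_ker_eq

theorem ker_ε (R : MinimalFreeResolution N) :
    LinearMap.ker R.ε.toLin = LinearMap.range (R.d 0).toLin :=
  R.exact_zero.linearMap_ker_eq

theorem stablyEquivModulo_range (R S : MinimalFreeResolution N) (n : ℕ) :
    StablyEquivModulo (irrelevantIdeal 𝒜) (LinearMap.range (R.d n).toLin)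
      (LinearMap.range (S.d n).toLin) := by
  induction n with
  | zero =>
    have := R.free_F 0
    have := S.free_F 0
    refine ((StablyEquivModulo.refl (irrelevantIdeal 𝒜) N.carrier).ker R.ε_surjective
      (R.ker_ε.trans_le (R.minimal 0)) S.ε_surjective
      (S.ker_ε.trans_le (S.minimal 0))).congr
      (LinearEquiv.ofEq _ _ R.ker_ε) (LinearEquiv.ofEq _ _ S.ker_ε)
  | succ n ih =>
    have := R.free_F (n + 1)
    have := S.free_F (n + 1)
    exact (ih.ker (R.d n).toLin.surjective_rangeRestrict
      ((R.ker_rangeRestrict_d n).trans_le (R.minimal (n + 1)))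
      (S.d n).toLin.surjective_rangeRestrict
      ((S.ker_rangeRestrict_d n).trans_le (S.minimal (n + 1)))).congr
      (LinearEquiv.ofEq _ _ (R.ker_rangeRestrict_d n))
      (LinearEquiv.ofEq _ _ (S.ker_rangeRestrict_d n))

/-- The Betti numbers do not depend on the minimal free resolution. -/
theorem rank_F_eq (h𝒜 : irrelevantIdeal 𝒜 ≠ ⊤) (R S : MinimalFreeResolution N) (n : ℕ) :
    Module.rank A (R.F n).carrier = Module.rank A (S.F n).carrier := by
  have := R.free_F n
  have := S.free_F n
  cases n with
  | zero =>
    obtain ⟨e⟩ := quotient_equiv_of_ker_le R.ε_surjective (R.ker_ε.trans_le (R.minimal 0))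
    obtain ⟨e'⟩ := quotient_equiv_of_ker_le S.ε_surjective (S.ker_ε.trans_le (S.minimal 0))
    exact rank_eq_of_quotient_equiv h𝒜 (e ≪≫ₗ e'.symm)
  | succ n =>
    obtain ⟨e⟩ := quotient_equiv_of_ker_le (R.d n).toLin.surjective_rangeRestrict
      ((R.ker_rangeRestrict_d n).trans_le (R.minimal (n + 1)))
    obtain ⟨e'⟩ := quotient_equiv_of_ker_le (S.d n).toLin.surjective_rangeRestrict
      ((S.ker_rangeRestrict_d n).trans_le (S.minimal (n + 1)))
    obtain ⟨e''⟩ := (stablyEquivModulo_range R S n).nonempty_quotient_equiv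
    exact rank_eq_of_quotient_equiv h𝒜 (e ≪≫ₗ e'' ≪≫ₗ e'.symm)

theorem bettiSum_eq (h𝒜 : irrelevantIdeal 𝒜 ≠ ⊤) (R S : MinimalFreeResolution N) :
    R.bettiSum = S.bettiSum :=
  congrArg Cardinal.sum (funext fun n => rank_F_eq h𝒜 R S n)

end GrMod.MinimalFreeResolution

end Resolution

end MinimalResolutions

/-! ### Totalings: splitting of the homology and decomposability of brackets -/

section TotComponents

set_option linter.unusedSectionVars false

variable {k A : Type u} [Field k] [CommRing A] [Algebra k A] {𝒜 : ℤ → Submodule k A}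
  [GradedAlgebra 𝒜]

/-- Every idempotent endomorphism of degree zero is `0` or `1`. -/
def GrMod.IdempotentsTrivial (N : GrMod 𝒜) : Prop :=
  ∀ π : N.carrier →ₗ[A] N.carrier, (∀ j, ∀ x ∈ N.deg j, π x ∈ N.deg j) → π ∘ₗ π = π →
    π = 0 ∨ π = LinearMap.id

/-- The projection onto the first summand is an idempotent; when it is `0` the first summand
vanishes, when it is `1` the second does. -/
theorem GrMod.IdempotentsTrivial.isIndecomposable {N : GrMod 𝒜} (h : N.IdempotentsTrivial)
    (hN : Nontrivial N.carrier) : N.IsIndecomposable := by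
  refine ⟨hN, fun P Q e he => ?_⟩
  let f : P.carrier →ₗ[A] N.carrier := e.toLinearMap ∘ₗ LinearMap.inl A P.carrier Q.carrier
  let g : Q.carrier →ₗ[A] N.carrier := e.toLinearMap ∘ₗ LinearMap.inr A P.carrier Q.carrier
  have hf : ∀ j, ∀ p ∈ P.deg j, f p ∈ N.deg j := fun j p hp => he j p hp 0 (AddSubgroup.zero_mem _)
  have hg : ∀ j, ∀ q ∈ Q.deg j, g q ∈ N.deg j := fun j q hq => he j 0 (AddSubgroup.zero_mem _) q hq
  have hfg : ∀ p q, e (p, q) = f p + g q := fun p q => by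
    simp only [f, g, LinearMap.comp_apply, LinearEquiv.coe_coe, ← map_add]
    simp
  let π : N.carrier →ₗ[A] N.carrier :=
    f ∘ₗ LinearMap.fst A P.carrier Q.carrier ∘ₗ e.symm.toLinearMap
  have hπ : ∀ p q, π (e (p, q)) = f p := fun p q => by simp [π]
  have hdeg : ∀ j, ∀ x ∈ N.deg j, π x ∈ N.deg j := by
    intro j x hx
    obtain ⟨⟨p, q⟩, rfl⟩ := e.surjective x
    rw [hπ]
    -- The hypothesis only says that `e` preserves degrees. Comparing with the degree projections
    -- shows that a homogeneous value forces homogeneous coordinates.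
    have h₁ : N.proj j (e (p, q)) = e (P.proj j p, Q.proj j q) := by
      rw [hfg, map_add, hfg]
      exact congrArg₂ (· + ·) (GrMod.proj_map f.toAddMonoidHom hf j p)
        (GrMod.proj_map g.toAddMonoidHom hg j q)
    rw [N.proj_same hx] at h₁
    have h₂ : p = P.proj j p := congrArg Prod.fst (e.injective h₁)
    rw [h₂]
    exact hf j _ (P.proj_mem j p)
  have hidem : π ∘ₗ π = π := by
    refine LinearMap.ext fun x => ?_
    obtain ⟨⟨p, q⟩, rfl⟩ := e.surjective x
    have : f p = e (p, 0) := by rw [hfg, map_zero, add_zero]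
    rw [LinearMap.comp_apply, hπ, this, hπ, this]
  rcases h π hdeg hidem with h0 | h1
  · left
    refine subsingleton_of_forall_eq 0 fun p => ?_
    have : e (p, 0) = 0 := by rw [hfg, ← hπ p 0, h0]; simp
    simpa using e.map_eq_zero_iff.1 this
  · right
    refine subsingleton_of_forall_eq 0 fun q => ?_
    have : e (0, q) = 0 := by
      have := hπ 0 q
      rwa [h1, map_zero] at this
    simpa using e.map_eq_zero_iff.1 this

namespace Tot

variable (X : CochainComplex (GrMod 𝒜) ℤ)

/-- The projection of the totaling onto the summand of index `s`. -/
def component (s : ℤ) : (obj X).carrier →ₗ[A] (obj X).carrier :=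
  DirectSum.lof A ℤ (fun i => ((X.X i).shift (-i)).carrier) s ∘ₗ
    DirectSum.component A ℤ (fun i => ((X.X i).shift (-i)).carrier) s

theorem component_apply (s : ℤ) (x : Carrier X) :
    component X s x = DirectSum.of (fun i => ((X.X i).shift (-i)).carrier) s (x s) := rfl

theorem component_component (s : ℤ) (x : (obj X).carrier) :
    component X s (component X s x) = component X s x := by
  change Carrier X at x
  rw [component_apply, component_apply, DirectSum.of_eq_same]

theorem component_component_of_ne {s t : ℤ} (hst : t ≠ s) (x : (obj X).carrier) :
    component X t (component X s x) = 0 := by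
  change Carrier X at x
  rw [component_apply, component_apply, DirectSum.of_eq_of_ne _ _ _ hst, map_zero]
  rfl

/-- This shift of the index by exactly one is the structure that a general DG module lacks and on
which the obstruction rests. -/
theorem d_component (s : ℤ) (x : (obj X).carrier) :
    (obj X).d (component X s x) = component X (s + 1) ((obj X).d x) := by
  change Carrier X at x
  change diff X (component X s x) = component X (s + 1) (diff X x)
  rw [component_apply, component_apply, diff_of, diff_apply]

theorem component_mem_deg (s : ℤ) {j : ℤ} {x : (obj X).carrier} (hx : x ∈ (obj X).deg j) :
    component X s x ∈ (obj X).deg j := by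
  change Carrier X at x
  intro i
  rw [component_apply]
  by_cases h : s = i
  · subst h
    rw [DirectSum.of_eq_same]
    exact hx s
  · rw [DirectSum.of_eq_of_ne _ _ _ (Ne.symm h)]
    exact AddSubgroup.zero_mem _

theorem exists_eq_sum_component (x : (obj X).carrier) :
    ∃ t : Finset ℤ, x = ∑ s ∈ t, component X s x := by
  classical
  exact ⟨_, (DirectSum.sum_support_of (β := fun i => ((X.X i).shift (-i)).carrier) x).symm⟩

theorem d_component_cycle (s : ℤ) {x : (obj X).carrier} (hx : (obj X).d x = 0) :
    (obj X).d (component X s x) = 0 := by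
  rw [d_component, hx, map_zero]

/-- The projection of the homology of the totaling onto the summand of index `s`. -/
def homologyComponent (s : ℤ) : (obj X).homology.carrier →ₗ[A] (obj X).homology.carrier :=
  Submodule.mapQ ((obj X).boundaries.submoduleOf (obj X).cycles)
    ((obj X).boundaries.submoduleOf (obj X).cycles)
    ((component X s).restrict (p := (obj X).cycles) (q := (obj X).cycles)
      (fun _ hx => d_component_cycle X s hx))
    (by
      rintro ⟨_, hx⟩ ⟨y, rfl⟩
      -- A boundary of index `s` comes from the part of index `s - 1`.
      refine ⟨component X (s - 1) y, ?_⟩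
      rw [d_component, sub_add_cancel]
      rfl)

theorem homologyComponent_homologyClass (s : ℤ) {x : (obj X).carrier} (hx : (obj X).d x = 0) :
    homologyComponent X s ((obj X).homologyClass x hx) =
      (obj X).homologyClass (component X s x) (d_component_cycle X s hx) := rfl

theorem homologyComponent_mem_deg (s j : ℤ) (h : (obj X).homology.carrier)
    (hh : h ∈ (obj X).homology.deg j) : homologyComponent X s h ∈ (obj X).homology.deg j := by
  obtain ⟨x, hx, hj, rfl⟩ := (obj X).exists_of_mem_homology_deg hh
  exact (obj X).homologyClass_mem_deg _ (component_mem_deg X s hj)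

theorem homologyComponent_comp_self (s : ℤ) :
    homologyComponent X s ∘ₗ homologyComponent X s = homologyComponent X s := by
  refine LinearMap.ext fun h => ?_
  obtain ⟨x, hx, rfl⟩ := (obj X).exists_homologyClass h
  rw [LinearMap.comp_apply, homologyComponent_homologyClass, homologyComponent_homologyClass]
  exact (obj X).homologyClass_congr _ (component_component X s x)

variable {X}

/-- If the homology of a totaling has no idempotents, it is concentrated in one summand. -/
theorem exists_component_sub_eq_d (htriv : (obj X).homology.IdempotentsTrivial)
    (hnon : Nontrivial (obj X).homology.carrier) :
    ∃ s, ∀ x, (obj X).d x = 0 → ∃ y, (obj X).d y = x - component X s x := by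
  by_cases h : ∃ s, homologyComponent X s = LinearMap.id
  · obtain ⟨s, hs⟩ := h
    refine ⟨s, fun x hx => ?_⟩
    rw [← (obj X).homologyClass_eq hx (d_component_cycle X s hx),
      ← homologyComponent_homologyClass, hs, LinearMap.id_apply]
  · exfalso
    push Not at h
    -- If no component is the identity, all of them vanish on homology; but a cycle is the finite
    -- sum of its components, so every class would be zero.
    have h0 : ∀ s, homologyComponent X s = 0 := fun s =>
      (htriv _ (homologyComponent_mem_deg X s) (homologyComponent_comp_self X s)).resolve_right
        (h s)
    obtain ⟨c, hc⟩ := exists_ne (0 : (obj X).homology.carrier)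
    obtain ⟨x, hx, rfl⟩ := (obj X).exists_homologyClass c
    refine hc (((obj X).homologyClass_eq_zero hx).2 ?_)
    have hb : ∀ s, ∃ y, (obj X).d y = component X s x := fun s => by
      rw [← (obj X).homologyClass_eq_zero (d_component_cycle X s hx),
        ← homologyComponent_homologyClass X s hx, h0, LinearMap.zero_apply]
    choose y hy using hb
    obtain ⟨t, ht⟩ := exists_eq_sum_component X x
    refine ⟨∑ s ∈ t, y s, ?_⟩
    rw [map_sum]
    conv_rhs => rw [ht]
    exact Finset.sum_congr rfl fun s _ => hy s

/-- In the homology of a totaling that has no idempotents, brackets are decomposable. -/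
theorem exists_eq_smul_add_smul_of_mem_bracket (htriv : (obj X).homology.IdempotentsTrivial)
    (hnon : Nontrivial (obj X).homology.carrier) {a₁ a₂ b₁ b₂ : A}
    (hab : signTwist 𝒜 1 b₁ * a₁ + signTwist 𝒜 1 b₂ * a₂ = 0) {h : (obj X).homology.carrier}
    (hh : h ∈ (obj X).bracket a₁ a₂ b₁ b₂) :
    ∃ α β : (obj X).homology.carrier, h = b₁ • α + b₂ • β := by
  obtain ⟨s, hs⟩ := exists_component_sub_eq_d htriv hnon
  obtain ⟨u, v₁, v₂, hu, h₁, h₂, hc, rfl⟩ := hh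
  obtain ⟨t, ht⟩ := hs u hu
  -- the component of `u` of index `s + 1` is a boundary
  have key : (obj X).d (component X s t) =
      component X (s + 1) u := by
    rw [d_component, ht, map_sub]
    rw [component_component_of_ne X (by omega), sub_zero]
  set w := component X s t with hw
  -- The component of `v` of index `s` has boundary `a` times the component of `u` of index `s + 1`,
  -- which is `a ∂w`; subtracting the twisted multiple of `w` leaves a cycle.
  have hcyc : ∀ (a : A) (v : (obj X).carrier), (obj X).d v = a • u →
      (obj X).d (component X s v - signTwist 𝒜 1 a • w) = 0 := by
    intro a v hv
    rw [map_sub, d_component, hv, map_smul, DGMod.d_smul, signTwist_signTwist, key, sub_self]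
  have hab' : b₁ * signTwist 𝒜 1 a₁ + b₂ * signTwist 𝒜 1 a₂ = 0 := by
    have := congrArg (signTwist 𝒜 1) hab
    simpa [signTwist_signTwist] using this
  refine ⟨(obj X).homologyClass _ (hcyc a₁ v₁ h₁), (obj X).homologyClass _ (hcyc a₂ v₂ h₂), ?_⟩
  rw [← DGMod.homologyClass_smul, ← DGMod.homologyClass_smul, ← DGMod.homologyClass_add,
    DGMod.homologyClass_eq]
  -- The class of `b₁v₁ + b₂v₂` is represented by its component of index `s`, and the corrections by
  -- `w` cancel by `hab'`.
  obtain ⟨y, hy⟩ := hs _ hc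
  refine ⟨y, ?_⟩
  have e : b₁ • (component X s v₁ - signTwist 𝒜 1 a₁ • w) +
      b₂ • (component X s v₂ - signTwist 𝒜 1 a₂ • w) =
      component X s (b₁ • v₁ + b₂ • v₂) -
        (b₁ * signTwist 𝒜 1 a₁ + b₂ * signTwist 𝒜 1 a₂) • w := by
    rw [map_add, map_smul, map_smul, smul_sub, smul_sub, add_smul, smul_smul, smul_smul]
    abel
  rw [e, hab', zero_smul, sub_zero, hy]

end Tot

theorem GrMod.IdempotentsTrivial.of_equiv {N N' : GrMod 𝒜} (h : N.IdempotentsTrivial)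
    (θ : N.carrier ≃ₗ[A] N'.carrier) (hθ : ∀ j, ∀ x ∈ N.deg j, θ x ∈ N'.deg j) :
    N'.IdempotentsTrivial := by
  have hsymm : ∀ j, ∀ y ∈ N'.deg j, θ.symm y ∈ N.deg j := fun j y hy =>
    GrMod.mem_deg_of_map_mem θ.toLinearMap.toAddMonoidHom hθ θ.injective
      (by change θ (θ.symm y) ∈ _; rwa [θ.apply_symm_apply])
  intro π hπ hidem
  have hidem' : (θ.symm.toLinearMap ∘ₗ π ∘ₗ θ.toLinearMap) ∘ₗ
      (θ.symm.toLinearMap ∘ₗ π ∘ₗ θ.toLinearMap) = θ.symm.toLinearMap ∘ₗ π ∘ₗ θ.toLinearMap := by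
    refine LinearMap.ext fun x => ?_
    have := LinearMap.congr_fun hidem (θ x)
    simp only [LinearMap.comp_apply] at this
    simp [this]
  rcases h (θ.symm.toLinearMap ∘ₗ π ∘ₗ θ.toLinearMap)
    (fun j x hx => hsymm j _ (hπ j _ (hθ j x hx))) hidem' with h0 | h1
  · left
    refine LinearMap.ext fun y => ?_
    have := LinearMap.congr_fun h0 (θ.symm y)
    simpa using this
  · right
    refine LinearMap.ext fun y => ?_
    have := congrArg θ (LinearMap.congr_fun h1 (θ.symm y))
    simpa using this

/-- A DG module whose homology has no idempotents, and in whose homology some bracket is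
indecomposable, does not become isomorphic to a totaling in the derived category. -/
theorem DGMod.isEmpty_iso_tot {M : DGMod 𝒜} (htriv : M.homology.IdempotentsTrivial)
    (hnon : Nontrivial M.homology.carrier) {a₁ a₂ b₁ b₂ : A}
    (hab : signTwist 𝒜 1 b₁ * a₁ + signTwist 𝒜 1 b₂ * a₂ = 0) {h : M.homology.carrier}
    (hh : h ∈ M.bracket a₁ a₂ b₁ b₂)
    (hind : ∀ α β : M.homology.carrier, h ≠ b₁ • α + b₂ • β)
    (X : CochainComplex (GrMod 𝒜) ℤ) :
    IsEmpty ((DGMod.quasiIso 𝒜).Q.obj M ≅ (DGMod.quasiIso 𝒜).Q.obj ((tot 𝒜).obj X)) := by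
  refine ⟨fun i => ?_⟩
  obtain ⟨θ, hθ, hθb⟩ : ∃ θ : M.homology.carrier ≃ₗ[A] (Tot.obj X).homology.carrier,
      (∀ j, ∀ h ∈ M.homology.deg j, θ h ∈ (Tot.obj X).homology.deg j) ∧
      ∀ h ∈ M.bracket a₁ a₂ b₁ b₂, θ h ∈ (Tot.obj X).bracket a₁ a₂ b₁ b₂ :=
    DGMod.exists_linearEquiv_of_derived_iso hab i
  obtain ⟨α, β, hαβ⟩ := Tot.exists_eq_smul_add_smul_of_mem_bracket (htriv.of_equiv θ hθ)
    θ.symm.toEquiv.nontrivial hab (hθb h hh)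
  refine hind (θ.symm α) (θ.symm β) (θ.injective ?_)
  rw [map_add, map_smul, map_smul, θ.apply_symm_apply, θ.apply_symm_apply, hαβ]

/-- Every object of the localized category is the image of an actual complex, and the derived
functor sends it to the image of its totaling. -/
theorem not_mem_essImage_derivedTot {M : DGMod 𝒜}
    (h : ∀ X : CochainComplex (GrMod 𝒜) ℤ,
      IsEmpty ((DGMod.quasiIso 𝒜).Q.obj M ≅ (DGMod.quasiIso 𝒜).Q.obj ((tot 𝒜).obj X))) :
    ¬ (derivedTot 𝒜).essImage ((DGMod.quasiIso 𝒜).Q.obj M) := by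
  rintro ⟨Y, ⟨i⟩⟩
  obtain ⟨X, rfl⟩ := (Localization.Construction.objEquiv (GrMod.quasiIso 𝒜)).surjective Y
  have hfac : (GrMod.quasiIso 𝒜).Q ⋙ derivedTot 𝒜 = tot 𝒜 ⋙ (DGMod.quasiIso 𝒜).Q :=
    Localization.Construction.fac _ _
  exact (h X).false (i.symm ≪≫ (eqToIso hfac).app X)

end TotComponents

/-! ### Graded free modules and semifree DG modules of finite rank -/

section FreeModules

set_option linter.unusedSectionVars false

variable {k A : Type u} [Field k] [CommRing A] [Algebra k A] (𝒜 : ℤ → Submodule k A)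
  [GradedAlgebra 𝒜]

/-- The graded free module of finite rank with basis elements in the degrees `w i`. -/
abbrev GrMod.free {m : ℕ} (w : Fin m → ℤ) : GrMod 𝒜 where
  carrier := Fin m → A
  deg j :=
    { carrier := {v | ∀ i, v i ∈ 𝒜 (j - w i)}
      zero_mem' := fun i => Submodule.zero_mem _
      add_mem' := fun hx hy i => Submodule.add_mem _ (hx i) (hy i)
      neg_mem' := fun hx i => Submodule.neg_mem _ (hx i) }
  isInternal := by
    classical
    refine isInternal_of_sum_eq_zero _ ?_ ?_
    · intro v
      rw [← Finset.univ_sum_single v]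
      refine AddSubgroup.sum_mem _ fun i _ => ?_
      rw [← DirectSum.sum_support_decompose 𝒜 (v i)]
      rw [show (Pi.single i (∑ n ∈ (DirectSum.decompose 𝒜 (v i)).support,
          (DirectSum.decompose 𝒜 (v i) n : A)) : Fin m → A) =
          ∑ n ∈ (DirectSum.decompose 𝒜 (v i)).support,
            Pi.single i (DirectSum.decompose 𝒜 (v i) n : A) from
        map_sum (AddMonoidHom.single (fun _ : Fin m => A) i) _ _]
      refine AddSubgroup.sum_mem _ fun n _ => AddSubgroup.mem_iSup_of_mem (n + w i) ?_
      intro l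
      by_cases h : l = i
      · subst h
        rw [Pi.single_eq_same, add_sub_cancel_right]
        exact (DirectSum.decompose 𝒜 (v l) n).2
      · rw [Pi.single_eq_of_ne h]
        exact Submodule.zero_mem _
    · intro s f hf h j hj
      funext i
      have h₁ : ∑ l ∈ s, f l i = 0 := by rw [← Finset.sum_apply, h, Pi.zero_apply]
      have h₂ := congrArg (GradedRing.proj 𝒜 (j - w i)) h₁
      rw [map_sum, map_zero, Finset.sum_eq_single j] at h₂
      · rw [GradedRing.proj_apply, DirectSum.decompose_of_mem_same 𝒜 (hf j i)] at h₂
        exact h₂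
      · intro l _ hl
        rw [GradedRing.proj_apply, DirectSum.decompose_of_mem_ne 𝒜 (hf l i) (by omega)]
      · exact fun h => absurd hj h
  smul_mem := by
    intro n j a v ha hv i
    change a * v i ∈ _
    rw [add_sub_assoc]
    exact SetLike.mul_mem_graded ha (hv i)

theorem GrMod.isGradedFree_free {m : ℕ} (w : Fin m → ℤ) : (GrMod.free 𝒜 w).IsGradedFree := by
  -- `IsGradedFree` asks for an index type in universe `u`, hence the lift of `Fin m`.
  refine ⟨ULift (Fin m), (Pi.basisFun A (Fin m)).reindex Equiv.ulift.symm, fun i => ⟨w i.down, ?_⟩⟩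
  intro l
  rw [Module.Basis.reindex_apply, Pi.basisFun_apply]
  change (Pi.single i.down 1 : Fin m → A) l ∈ _
  by_cases h : l = i.down
  · subst h
    rw [Pi.single_eq_same, sub_self]
    exact SetLike.one_mem_graded 𝒜
  · rw [Pi.single_eq_of_ne h]
    exact Submodule.zero_mem _

theorem GrMod.rank_free [Nontrivial A] {m : ℕ} (w : Fin m → ℤ) :
    Module.rank A (GrMod.free 𝒜 w).carrier = m := by
  change Module.rank A (Fin m → A) = m
  simp

variable {𝒜}

/-- The morphism from a graded free module determined by the images of the basis elements. -/
def GrMod.freeHom {m : ℕ} {w : Fin m → ℤ} (N : GrMod 𝒜) (c : Fin m → N.carrier)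
    (hc : ∀ i, c i ∈ N.deg (w i)) : GrMod.free 𝒜 w ⟶ N :=
  GrMod.Hom.mk (Fintype.linearCombination A c) (fun {j v} hv => by
    rw [Fintype.linearCombination_apply]
    refine AddSubgroup.sum_mem _ fun i _ => ?_
    have := N.smul_mem (hv i) (hc i)
    rwa [sub_add_cancel] at this)

theorem GrMod.freeHom_apply {m : ℕ} {w : Fin m → ℤ} (N : GrMod 𝒜) (c : Fin m → N.carrier)
    (hc : ∀ i, c i ∈ N.deg (w i)) (v : Fin m → A) :
    (GrMod.freeHom N c hc).toLin v = ∑ i, v i • c i :=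
  Fintype.linearCombination_apply A c v

theorem signTwist_mem (i : ℤ) {n : ℤ} {a : A} (ha : a ∈ 𝒜 n) : signTwist 𝒜 i a ∈ 𝒜 n := by
  rw [signTwist_of_mem i ha, Units.smul_def]
  exact zsmul_mem ha _

/-- The DG module with underlying graded module `GrMod.free 𝒜 w` whose differential maps the
`i`-th basis element to `D i`. -/
abbrev DGMod.semifree {m : ℕ} (w : Fin m → ℤ) (D : Fin m → Fin m → A)
    (hD : ∀ i, D i ∈ (GrMod.free 𝒜 w).deg (w i - 1))
    (hDD : ∀ i, ∑ l, signTwist 𝒜 1 (D i l) • D l = 0) : DGMod 𝒜 where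
  toGrMod := GrMod.free 𝒜 w
  d :=
    { toFun := fun v => ∑ i, signTwist 𝒜 1 (v i) • D i
      map_zero' := by
        change ∑ i, signTwist 𝒜 1 (0 : A) • D i = 0
        simp
      map_add' := fun v v' => by simp [add_smul, Finset.sum_add_distrib] }
  d_mem := by
    intro j v hv
    change ∑ i, signTwist 𝒜 1 (v i) • D i ∈ (GrMod.free 𝒜 w).deg (j - 1)
    refine AddSubgroup.sum_mem _ fun i _ => ?_
    have := (GrMod.free 𝒜 w).smul_mem (signTwist_mem 1 (hv i)) (hD i)
    rwa [show j - w i + (w i - 1) = j - 1 by ring] at this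
  d_d := by
    intro v
    change ∑ l, signTwist 𝒜 1 ((∑ i, signTwist 𝒜 1 (v i) • D i) l) • D l = 0
    -- In `∂²` the coefficient `v i` is twisted twice and comes out untwisted, so `∂² = 0` reduces
    -- to the condition `hDD` on basis elements.
    have h : ∀ l, signTwist 𝒜 1 ((∑ i, signTwist 𝒜 1 (v i) • D i) l) • D l =
        ∑ i, v i • signTwist 𝒜 1 (D i l) • D l := by
      intro l
      rw [Finset.sum_apply, map_sum, Finset.sum_smul]
      refine Finset.sum_congr rfl fun i _ => ?_
      rw [Pi.smul_apply, smul_eq_mul, map_mul, signTwist_signTwist, mul_smul]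
    rw [Finset.sum_congr rfl fun l _ => h l, Finset.sum_comm]
    refine Finset.sum_eq_zero fun i _ => ?_
    rw [← Finset.smul_sum, hDD, smul_zero]
  leibniz := by
    intro n a ha v
    change ∑ i, signTwist 𝒜 1 (a * v i) • D i = n.negOnePow • a • ∑ i, signTwist 𝒜 1 (v i) • D i
    simp only [map_mul, mul_smul]
    rw [← Finset.smul_sum, signTwist_of_mem 1 ha, mul_one, smul_assoc]

theorem mem_smul_top_of_forall_mem {I : Ideal A} {m : ℕ} {v : Fin m → A} (hv : ∀ i, v i ∈ I) :
    v ∈ I • (⊤ : Submodule A (Fin m → A)) := by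
  rw [← Finset.univ_sum_single v]
  refine Submodule.sum_mem _ fun i _ => ?_
  have : (Pi.single i (v i) : Fin m → A) = v i • Pi.single i 1 := by
    ext l
    simp [Pi.single_apply]
  rw [this]
  exact Submodule.smul_mem_smul (hv i) trivial

theorem GrMod.range_freeHom_le {I : Ideal A} {m n : ℕ} {w : Fin m → ℤ} {w' : Fin n → ℤ}
    (c : Fin m → Fin n → A) (hc : ∀ i, c i ∈ (GrMod.free 𝒜 w').deg (w i))
    (hI : ∀ i l, c i l ∈ I) :
    LinearMap.range (GrMod.freeHom (GrMod.free 𝒜 w') c hc).toLin ≤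
      I • (⊤ : Submodule A (GrMod.free 𝒜 w').carrier) := by
  rintro _ ⟨v, rfl⟩
  rw [GrMod.freeHom_apply]
  exact Submodule.sum_mem _ fun i _ => Submodule.smul_mem _ _ (mem_smul_top_of_forall_mem (hI i))

end FreeModules

/-! ### The standard grading of the polynomial ring -/

section StandardGrading

open MvPolynomial

variable {k : Type u} [Field k] {d : ℕ}

theorem X_mem_stdGrading (i : Fin d) : X i ∈ stdGrading k d 1 :=
  isWeightedHomogeneous_X k _ i

theorem X_pow_mem_stdGrading (i : Fin d) (n : ℕ) : X i ^ n ∈ stdGrading k d n := by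
  have := SetLike.pow_mem_graded (A := stdGrading k d) n (X_mem_stdGrading i)
  simpa using this

theorem X_pow_mul_X_pow_mem_stdGrading (i j : Fin d) (m n : ℕ) :
    X i ^ m * X j ^ n ∈ stdGrading k d (m + n) :=
  SetLike.mul_mem_graded (X_pow_mem_stdGrading i m) (X_pow_mem_stdGrading j n)

theorem weight_one_eq_degree (c : Fin d →₀ ℕ) :
    Finsupp.weight (fun _ : Fin d => (1 : ℤ)) c = (c.degree : ℤ) := by
  simp [Finsupp.weight_apply, Finsupp.degree_apply, Finsupp.sum]

theorem eq_zero_of_mem_stdGrading_neg {n : ℤ} (hn : n < 0) {p : MvPolynomial (Fin d) k}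
    (hp : p ∈ stdGrading k d n) : p = 0 := by
  ext c
  by_contra h
  have := hp h
  rw [weight_one_eq_degree] at this
  omega

theorem eq_C_of_mem_stdGrading_zero {p : MvPolynomial (Fin d) k} (hp : p ∈ stdGrading k d 0) :
    p = C (coeff 0 p) := by
  ext c
  rw [coeff_C]
  split_ifs with h
  · rw [← h]
  · by_contra hc
    have := hp hc
    rw [weight_one_eq_degree] at this
    exact h ((Finsupp.degree_eq_zero_iff c).1 (by exact_mod_cast this)).symm

theorem irrelevantIdeal_stdGrading_ne_top : GrMod.irrelevantIdeal (stdGrading k d) ≠ ⊤ := by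
  intro h
  have hle : GrMod.irrelevantIdeal (stdGrading k d) ≤
      RingHom.ker (constantCoeff : MvPolynomial (Fin d) k →+* k) := by
    refine Ideal.span_le.2 ?_
    rintro a ⟨n, hn, ha⟩
    by_contra hc
    -- Here `d` names the exponent in the definition of weighted homogeneity: a nonzero constant
    -- coefficient forces degree 0.
    have := ha (d := 0) (fun h => hc h)
    rw [map_zero] at this
    omega
  rw [h] at hle
  have : (1 : MvPolynomial (Fin d) k) ∈ RingHom.ker (constantCoeff (σ := Fin d) (R := k)) :=
    hle trivial
  simp at this

theorem X_mem_irrelevantIdeal (i : Fin d) :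
    (X i : MvPolynomial (Fin d) k) ∈ GrMod.irrelevantIdeal (stdGrading k d) :=
  Ideal.subset_span ⟨1, one_pos, X_mem_stdGrading i⟩

theorem signTwist_one_X (i : Fin d) :
    signTwist (stdGrading k d) 1 (X i) = -X i := by
  rw [signTwist_of_mem 1 (X_mem_stdGrading i)]
  simp

/-- The syzygies of `X i` and a power of another variable. -/
theorem exists_eq_mul_of_mul_X_eq_mul_X_pow {i j : Fin d} (hij : i ≠ j) {n : ℕ}
    {a b : MvPolynomial (Fin d) k} (h : a * X i = b * X j ^ n) :
    ∃ g, a = g * X j ^ n ∧ b = g * X i := by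
  have hp : Prime (X i : MvPolynomial (Fin d) k) := X_prime
  have hdvd : (X i : MvPolynomial (Fin d) k) ∣ b := by
    refine (hp.dvd_or_dvd (Dvd.intro_left a h)).resolve_right fun hj => ?_
    -- At the point with `i`-th coordinate 0 and all others 1, multiples of `X i` vanish while `X j
    -- ^ n` does not.
    have h₁ : eval (fun l => if l = i then (0 : k) else 1) (X j ^ n) = 1 := by
      simp [hij.symm]
    obtain ⟨c, hc⟩ := hj
    rw [hc] at h₁
    simp at h₁
  obtain ⟨g, rfl⟩ := hdvd
  refine ⟨g, mul_right_cancel₀ hp.ne_zero ?_, mul_comm _ _⟩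
  rw [h]; ring

end StandardGrading

/-! ### The DG module of rank four: construction, cycles and boundaries -/

section RankFour

open MvPolynomial

variable (k : Type u) [Field k] {d : ℕ} (i j : Fin d)

/-- The differentials of the basis elements of `rankFour`. -/
def rankFourD : Fin 4 → Fin 4 → MvPolynomial (Fin d) k :=
  ![0, ![X i * X j, 0, 0, 0], ![X j ^ 3, 0, 0, 0], ![X i ^ 7, X j ^ 4, X i * X j ^ 2, 0]]

variable {k} in
theorem X_mul_X_pow_mem_stdGrading (n : ℕ) :
    (X i * X j ^ n : MvPolynomial (Fin d) k) ∈ stdGrading k d (1 + n) := by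
  simpa using X_pow_mul_X_pow_mem_stdGrading (k := k) i j 1 n

theorem rankFourD_mem_deg (l : Fin 4) :
    rankFourD k i j l ∈ (GrMod.free (stdGrading k d) ![0, 3, 4, 8]).deg (![0, 3, 4, 8] l - 1) := by
  have h0 : ∀ n, (0 : MvPolynomial (Fin d) k) ∈ stdGrading k d n := fun n => Submodule.zero_mem _
  have h1 : (X i * X j : MvPolynomial (Fin d) k) ∈ stdGrading k d 2 := by
    simpa using X_mul_X_pow_mem_stdGrading (k := k) i j 1
  match l with
  | 0 => exact fun n => h0 _
  | 1 => exact fun n => match n with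
    | 0 => h1
    | 1 => h0 _
    | 2 => h0 _
    | 3 => h0 _
  | 2 => exact fun n => match n with
    | 0 => X_pow_mem_stdGrading j 3
    | 1 => h0 _
    | 2 => h0 _
    | 3 => h0 _
  | 3 => exact fun n => match n with
    | 0 => X_pow_mem_stdGrading i 7
    | 1 => X_pow_mem_stdGrading j 4
    | 2 => X_mul_X_pow_mem_stdGrading i j 2
    | 3 => h0 _

/-- The only nontrivial case is the last basis element: `X j ^ 4` has even degree and `X i * X j ^
2` odd degree, so the two contributions `X i * X j ^ 5` cancel. -/
theorem signTwist_rankFourD (l : Fin 4) :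
    ∑ n, signTwist (stdGrading k d) 1 (rankFourD k i j l n) • rankFourD k i j n = 0 := by
  rw [Fin.sum_univ_four]
  fin_cases l <;> ext n : 1 <;> fin_cases n <;> simp [rankFourD, signTwist_one_X]
  ring

/-- The semifree DG module of rank four with basis elements in degrees `0, 3, 4, 8`. -/
abbrev rankFour : DGMod (stdGrading k d) :=
  DGMod.semifree ![0, 3, 4, 8] (rankFourD k i j) (rankFourD_mem_deg k i j)
    (signTwist_rankFourD k i j)

variable {k} in
theorem rankFour_d_apply (v : Fin 4 → MvPolynomial (Fin d) k) :
    (rankFour k i j).d v =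
      ![signTwist (stdGrading k d) 1 (v 1) * (X i * X j) +
          signTwist (stdGrading k d) 1 (v 2) * X j ^ 3 +
          signTwist (stdGrading k d) 1 (v 3) * X i ^ 7,
        signTwist (stdGrading k d) 1 (v 3) * X j ^ 4,
        signTwist (stdGrading k d) 1 (v 3) * (X i * X j ^ 2), 0] := by
  change ∑ l, signTwist (stdGrading k d) 1 (v l) • rankFourD k i j l = _
  rw [Fin.sum_univ_four]
  ext n : 1
  fin_cases n <;> simp [rankFourD]

/-- The semibasis of `rankFour`. -/
def rankFourBasis : Module.Basis (Fin 4) (MvPolynomial (Fin d) k) (rankFour k i j).carrier :=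
  Pi.basisFun (MvPolynomial (Fin d) k) (Fin 4)

theorem rankFourBasis_apply (l : Fin 4) :
    rankFourBasis k i j l = (Pi.single l 1 : Fin 4 → MvPolynomial (Fin d) k) :=
  Pi.basisFun_apply _ _ l

theorem rankFourBasis_mem_deg (l : Fin 4) :
    rankFourBasis k i j l ∈ (rankFour k i j).deg (![0, 3, 4, 8] l) := by
  rw [rankFourBasis_apply]
  intro n
  by_cases h : n = l
  · subst h
    rw [Pi.single_eq_same, sub_self]
    exact SetLike.one_mem_graded (stdGrading k d)
  · rw [Pi.single_eq_of_ne h]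
    exact Submodule.zero_mem _

theorem rankFour_d_basis_zero : (rankFour k i j).d (rankFourBasis k i j 0) = 0 := by
  rw [rankFourBasis_apply, rankFour_d_apply]
  change _ = (0 : Fin 4 → MvPolynomial (Fin d) k)
  ext n : 1
  fin_cases n <;> simp

theorem rankFour_d_basis_one : (rankFour k i j).d (rankFourBasis k i j 1) =
    (X i * X j : MvPolynomial (Fin d) k) • rankFourBasis k i j 0 := by
  rw [rankFourBasis_apply k i j 1, rankFourBasis_apply k i j 0,
    rankFour_d_apply]
  change _ = (X i * X j : MvPolynomial (Fin d) k) • (Pi.single 0 1 : Fin 4 → MvPolynomial (Fin d) k)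
  ext n : 1
  fin_cases n <;> simp

theorem rankFour_d_basis_two : (rankFour k i j).d (rankFourBasis k i j 2) =
    (X j ^ 3 : MvPolynomial (Fin d) k) • rankFourBasis k i j 0 := by
  rw [rankFourBasis_apply k i j 2, rankFourBasis_apply k i j 0,
    rankFour_d_apply]
  change _ = (X j ^ 3 : MvPolynomial (Fin d) k) • (Pi.single 0 1 : Fin 4 → MvPolynomial (Fin d) k)
  ext n : 1
  fin_cases n <;> simp

theorem rankFour_d_basis_three : (rankFour k i j).d (rankFourBasis k i j 3) =
    (X i ^ 7 : MvPolynomial (Fin d) k) • rankFourBasis k i j 0 +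
      (X j ^ 4 : MvPolynomial (Fin d) k) • rankFourBasis k i j 1 +
      (X i * X j ^ 2 : MvPolynomial (Fin d) k) • rankFourBasis k i j 2 := by
  rw [rankFourBasis_apply k i j 3, rankFourBasis_apply k i j 0, rankFourBasis_apply k i j 1,
    rankFourBasis_apply k i j 2,
    rankFour_d_apply]
  change _ = (X i ^ 7 : MvPolynomial (Fin d) k) • (Pi.single 0 1 : Fin 4 → MvPolynomial (Fin d) k) +
    (X j ^ 4 : MvPolynomial (Fin d) k) • (Pi.single 1 1 : Fin 4 → MvPolynomial (Fin d) k) +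
    (X i * X j ^ 2 : MvPolynomial (Fin d) k) • (Pi.single 2 1 : Fin 4 → MvPolynomial (Fin d) k)
  ext n : 1
  fin_cases n <;> simp

theorem rankFour_isSemibasis : (rankFour k i j).IsSemibasis (rankFourBasis k i j) := by
  -- The levels are those of the filtration: the two middle basis elements have boundaries in the
  -- span of the first, the last one in the span of the other three.
  refine ⟨fun l => ⟨_, rankFourBasis_mem_deg k i j l⟩, ![0, 1, 1, 2], fun l => ?_⟩
  have hs : ∀ (n : Fin 4) (a : MvPolynomial (Fin d) k),
      (![0, 1, 1, 2] : Fin 4 → ℕ) n < (![0, 1, 1, 2] : Fin 4 → ℕ) l →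
      a • rankFourBasis k i j n ∈ Submodule.span (MvPolynomial (Fin d) k)
        (rankFourBasis k i j ''
          {l' | (![0, 1, 1, 2] : Fin 4 → ℕ) l' < (![0, 1, 1, 2] : Fin 4 → ℕ) l}) :=
    fun n a h => Submodule.smul_mem _ a (Submodule.subset_span ⟨n, h, rfl⟩)
  match l with
  | 0 => rw [rankFour_d_basis_zero]; exact Submodule.zero_mem _
  | 1 => rw [rankFour_d_basis_one]; exact hs _ _ (by decide)
  | 2 => rw [rankFour_d_basis_two]; exact hs _ _ (by decide)
  | 3 =>
    rw [rankFour_d_basis_three]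
    exact Submodule.add_mem _ (Submodule.add_mem _ (hs _ _ (by decide)) (hs _ _ (by decide)))
      (hs _ _ (by decide))

variable {k i j}

/-- The last coordinate dies because `X j ^ 4` is a nonzerodivisor. What remains, after untwisting
and cancelling `X j`, is a syzygy of `X i` and `X j ^ 2`, a multiple of the Koszul one. -/
theorem rankFour_exists_of_d_eq_zero (hij : i ≠ j) {v : Fin 4 → MvPolynomial (Fin d) k}
    (hv : (rankFour k i j).d v = 0) : ∃ a b, v = ![a, b * X j ^ 2, b * X i, 0] := by
  have hX : ∀ l : Fin d, (X l : MvPolynomial (Fin d) k) ≠ 0 := fun l => X_ne_zero l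
  rw [rankFour_d_apply] at hv
  have h₁ := congrFun hv 1
  have h₀ := congrFun hv 0
  change signTwist (stdGrading k d) 1 (v 3) * X j ^ 4 = 0 at h₁
  change signTwist (stdGrading k d) 1 (v 1) * (X i * X j) +
    signTwist (stdGrading k d) 1 (v 2) * X j ^ 3 +
    signTwist (stdGrading k d) 1 (v 3) * X i ^ 7 = 0 at h₀
  have h₃ := (mul_eq_zero.1 h₁).resolve_right (pow_ne_zero _ (hX j))
  rw [h₃, zero_mul, add_zero] at h₀
  have h₀' := congrArg (signTwist (stdGrading k d) 1) h₀
  simp only [map_add, map_mul, map_pow, signTwist_signTwist, signTwist_one_X, map_zero] at h₀'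
  have h₂ : v 1 * X i = v 2 * X j ^ 2 := by
    refine mul_right_cancel₀ (hX j) ?_
    linear_combination h₀'
  obtain ⟨g, hg₁, hg₂⟩ := exists_eq_mul_of_mul_X_eq_mul_X_pow hij h₂
  refine ⟨v 0, g, funext fun n => ?_⟩
  match n with
  | 0 => rfl
  | 1 => exact hg₁
  | 2 => exact hg₂
  | 3 => simpa [signTwist_signTwist] using congrArg (signTwist (stdGrading k d) 1) h₃

variable (i j) in
theorem rankFour_d_cycle (a b : MvPolynomial (Fin d) k) :
    (rankFour k i j).d ![a, b * X j ^ 2, b * X i, 0] = 0 := by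
  rw [rankFour_d_apply]
  change _ = (0 : Fin 4 → MvPolynomial (Fin d) k)
  ext n : 1
  fin_cases n <;> simp [signTwist_one_X]
  ring

variable (i j) in
-- The second and third coordinates of a boundary both say that `b` is `X j ^ 2` times the twisted
-- last coefficient; the first coordinate adds the multiples of the remaining two relations.
theorem rankFour_d_eq_cycle_iff (a b : MvPolynomial (Fin d) k) :
    (∃ v, (rankFour k i j).d v = ![a, b * X j ^ 2, b * X i, 0]) ↔
      ∃ α β γ, a = α * (X i * X j) + β * X j ^ 3 + γ * X i ^ 7 ∧ b = γ * X j ^ 2 := by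
  constructor
  · rintro ⟨v, hv⟩
    rw [rankFour_d_apply] at hv
    refine ⟨_, _, _, (congrFun hv 0).symm, ?_⟩
    have h₂ := congrFun hv 2
    change signTwist (stdGrading k d) 1 (v 3) * (X i * X j ^ 2) = b * X i at h₂
    refine mul_right_cancel₀ (X_ne_zero i) ?_
    linear_combination -h₂
  · rintro ⟨α, β, γ, rfl, rfl⟩
    let σ := signTwist (stdGrading k d) 1
    refine ⟨![0, σ α, σ β, σ γ], ?_⟩
    rw [rankFour_d_apply]
    ext n : 1
    fin_cases n <;> simp [σ, signTwist_signTwist] <;> ring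

variable (k i j) in
/-- The first generator of the homology of `rankFour`. -/
def rankFourClassZero : (rankFour k i j).homology.carrier :=
  -- The unreduced products keep the shape `![a, b * X j ^ 2, b * X i, 0]` for which
  -- `rankFour_d_cycle` is stated.
  (rankFour k i j).homologyClass ![1, 0 * X j ^ 2, 0 * X i, 0] (rankFour_d_cycle i j 1 0)

variable (k i j) in
/-- The second generator of the homology of `rankFour`. -/
def rankFourClassOne : (rankFour k i j).homology.carrier :=
  (rankFour k i j).homologyClass ![0, 1 * X j ^ 2, 1 * X i, 0] (rankFour_d_cycle i j 0 1)

theorem smul_rankFourClass_add (a b : MvPolynomial (Fin d) k) :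
    a • rankFourClassZero k i j + b • rankFourClassOne k i j =
      (rankFour k i j).homologyClass ![a, b * X j ^ 2, b * X i, 0] (rankFour_d_cycle i j a b) := by
  rw [rankFourClassZero, rankFourClassOne, ← DGMod.homologyClass_smul, ← DGMod.homologyClass_smul,
    ← DGMod.homologyClass_add]
  refine DGMod.homologyClass_congr _ _ ?_
  change a • (![1, 0 * X j ^ 2, 0 * X i, 0] : Fin 4 → MvPolynomial (Fin d) k) +
    b • (![0, 1 * X j ^ 2, 1 * X i, 0] : Fin 4 → MvPolynomial (Fin d) k) =
    ![a, b * X j ^ 2, b * X i, 0]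
  ext n : 1
  fin_cases n <;> simp

theorem smul_rankFourClass_add_eq_zero_iff (a b : MvPolynomial (Fin d) k) :
    a • rankFourClassZero k i j + b • rankFourClassOne k i j = 0 ↔
      ∃ α β γ, a = α * (X i * X j) + β * X j ^ 3 + γ * X i ^ 7 ∧ b = γ * X j ^ 2 := by
  rw [smul_rankFourClass_add, DGMod.homologyClass_eq_zero]
  exact rankFour_d_eq_cycle_iff i j a b

theorem exists_smul_rankFourClass_add (hij : i ≠ j) (h : (rankFour k i j).homology.carrier) :
    ∃ a b : MvPolynomial (Fin d) k,
      a • rankFourClassZero k i j + b • rankFourClassOne k i j = h := by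
  obtain ⟨v, hv, rfl⟩ := (rankFour k i j).exists_homologyClass h
  obtain ⟨a, b, rfl⟩ := rankFour_exists_of_d_eq_zero hij hv
  exact ⟨a, b, smul_rankFourClass_add a b⟩

theorem rankFourClass_mem_deg (l : Fin 2) :
    ![rankFourClassZero k i j, rankFourClassOne k i j] l ∈
      (rankFour k i j).homology.deg (![0, 5] l) := by
  have h0 : ∀ n, (0 : MvPolynomial (Fin d) k) ∈ stdGrading k d n := fun n => Submodule.zero_mem _
  have h1 : (1 : MvPolynomial (Fin d) k) ∈ stdGrading k d 0 :=
    SetLike.one_mem_graded (stdGrading k d)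
  match l with
  | 0 =>
    refine (rankFour k i j).homologyClass_mem_deg _ fun n => ?_
    match n with
    | 0 => exact h1
    | 1 => rw [zero_mul]; exact h0 _
    | 2 => rw [zero_mul]; exact h0 _
    | 3 => exact h0 _
  | 1 =>
    refine (rankFour k i j).homologyClass_mem_deg _ fun n => ?_
    match n with
    | 0 => exact h0 _
    | 1 => rw [one_mul]; exact X_pow_mem_stdGrading (k := k) j 2
    | 2 =>
      change 1 * X i ∈ stdGrading k d 1
      rw [one_mul]
      exact X_mem_stdGrading i
    | 3 => exact h0 _

end RankFour

/-! ### The homology of the rank-four module: idempotents, bracket, resolution -/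

section RankFourHomology

open MvPolynomial

variable {k : Type u} [Field k] {d : ℕ} {i j : Fin d}

variable (k i j) in
/-- The cover of the homology of `rankFour` by a graded free module of rank two. -/
def rankFourCover : GrMod.free (stdGrading k d) ![0, 5] ⟶ (rankFour k i j).homology :=
  GrMod.freeHom _ ![rankFourClassZero k i j, rankFourClassOne k i j] rankFourClass_mem_deg

theorem rankFourCover_apply (v : Fin 2 → MvPolynomial (Fin d) k) :
    (rankFourCover k i j).toLin v =
      v 0 • rankFourClassZero k i j + v 1 • rankFourClassOne k i j := by
  rw [rankFourCover, GrMod.freeHom_apply, Fin.sum_univ_two]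
  rfl

theorem rankFourCover_surjective (hij : i ≠ j) :
    Function.Surjective (rankFourCover k i j).toLin := by
  intro h
  obtain ⟨a, b, rfl⟩ := exists_smul_rankFourClass_add hij h
  exact ⟨![a, b], rankFourCover_apply _⟩

/-- The cover preserves degrees, so any preimage may be replaced by its projection to degree `n`,
whose coordinates are homogeneous. -/
theorem exists_of_mem_rankFour_homology_deg (hij : i ≠ j) {n : ℤ}
    {h : (rankFour k i j).homology.carrier} (hh : h ∈ (rankFour k i j).homology.deg n) :
    ∃ a ∈ stdGrading k d n, ∃ b ∈ stdGrading k d (n - 5),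
      h = a • rankFourClassZero k i j + b • rankFourClassOne k i j := by
  obtain ⟨v, rfl⟩ := rankFourCover_surjective hij h
  have hp := GrMod.proj_map (rankFourCover k i j).toLin.toAddMonoidHom
    (fun _ _ hx => (rankFourCover k i j).map_deg hx) n v
  change _ = (rankFourCover k i j).toLin _ at hp
  have hs := (rankFour k i j).homology.proj_same hh
  have hm := (GrMod.free (stdGrading k d) ![0, 5]).proj_mem n v
  refine ⟨_, by simpa using hm 0, _, hm 1, ?_⟩
  rw [← rankFourCover_apply, ← hp]
  exact hs.symm

/-- The coefficients of the first generator in the relations all vanish at the origin. -/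
theorem smul_rankFourClassZero_eq_zero {c : k}
    (h : (C c : MvPolynomial (Fin d) k) • rankFourClassZero k i j = 0) : c = 0 := by
  have h' : (C c : MvPolynomial (Fin d) k) • rankFourClassZero k i j +
      (0 : MvPolynomial (Fin d) k) • rankFourClassOne k i j = 0 := by
    rw [h, zero_smul, add_zero]
  obtain ⟨α, β, γ, h₁, h₂⟩ := (smul_rankFourClass_add_eq_zero_iff _ _).1 h'
  have := congrArg (eval (fun _ => (0 : k))) h₁
  simpa using this

theorem rankFour_homology_nontrivial :
    Nontrivial (rankFour k i j).homology.carrier := by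
  refine ⟨rankFourClassZero k i j, 0, fun h => one_ne_zero (α := k) ?_⟩
  refine smul_rankFourClassZero_eq_zero (i := i) (j := j) ?_
  rw [h, smul_zero]

theorem rankFour_relation :
    (X i ^ 7 : MvPolynomial (Fin d) k) • rankFourClassZero k i j +
      (X j ^ 2 : MvPolynomial (Fin d) k) • rankFourClassOne k i j = 0 :=
  (smul_rankFourClass_add_eq_zero_iff _ _).2 ⟨0, 0, 1, by ring, by ring⟩

/-- For degree reasons `π z₀ = r z₀` and `π z₁ = a z₀ + s z₁` with scalars `r`, `s`. The relation
between `z₀` and `z₁` gives `r = s`, idempotence gives `r = 0` or `r = 1`, and a second use of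
idempotence, on `z₁`, removes `a z₀`. -/
theorem rankFour_idempotentsTrivial (hij : i ≠ j) :
    (rankFour k i j).homology.IdempotentsTrivial := by
  intro π hπ hidem
  have hidem' : ∀ h, π (π h) = π h := fun h => LinearMap.congr_fun hidem h
  obtain ⟨a₀, ha₀, b₀, hb₀, h₀⟩ :=
    exists_of_mem_rankFour_homology_deg hij (hπ 0 _ (rankFourClass_mem_deg 0))
  obtain ⟨a, -, b, hb, h₁⟩ :=
    exists_of_mem_rankFour_homology_deg hij (hπ 5 _ (rankFourClass_mem_deg 1))
  change π (rankFourClassZero k i j) = _ at h₀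
  change π (rankFourClassOne k i j) = _ at h₁
  rw [eq_zero_of_mem_stdGrading_neg (by norm_num) hb₀, zero_smul, add_zero] at h₀
  obtain ⟨r, rfl⟩ : ∃ r, a₀ = C r := ⟨_, eq_C_of_mem_stdGrading_zero ha₀⟩
  obtain ⟨s, rfl⟩ : ∃ s, b = C s := ⟨_, eq_C_of_mem_stdGrading_zero hb⟩
  -- the relation between the generators forces the two scalars to agree
  have hrs : r = s := by
    have hrel := congrArg π (rankFour_relation (k := k) (i := i) (j := j))
    rw [map_add, map_smul, map_smul, map_zero, h₀, h₁, smul_add, smul_smul, smul_smul, smul_smul,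
      ← add_assoc, ← add_smul, smul_rankFourClass_add_eq_zero_iff] at hrel
    obtain ⟨α, β, γ, e₁, e₂⟩ := hrel
    have hγ : γ = C s := by
      refine mul_right_cancel₀ (pow_ne_zero 2 (X_ne_zero j)) ?_
      rw [← e₂, mul_comm]
    -- At the point with `i`-th coordinate 1 and all others 0, every term containing `X j`
    -- disappears and only the coefficients `r` and `s` of `X i ^ 7` survive.
    have := congrArg (eval (fun l => if l = i then (1 : k) else 0)) e₁
    simpa [hij.symm, hγ] using this
  subst hrs
  have hr : r * r - r = 0 := by
    refine smul_rankFourClassZero_eq_zero (i := i) (j := j) ?_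
    have := hidem' (rankFourClassZero k i j)
    rw [h₀, map_smul, h₀, smul_smul, ← C_mul] at this
    rw [C_sub, sub_smul, this, sub_self]
  have hr' : r = 0 ∨ r = 1 := by
    rcases mul_eq_zero.1 (show r * (r - 1) = 0 by linear_combination hr) with h | h
    · exact Or.inl h
    · exact Or.inr (sub_eq_zero.1 h)
  have hext : ∀ φ ψ : (rankFour k i j).homology.carrier →ₗ[MvPolynomial (Fin d) k]
      (rankFour k i j).homology.carrier,
      φ (rankFourClassZero k i j) = ψ (rankFourClassZero k i j) →
      φ (rankFourClassOne k i j) = ψ (rankFourClassOne k i j) → φ = ψ := by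
    intro φ ψ e₀ e₁
    refine LinearMap.ext fun h => ?_
    obtain ⟨a, b, rfl⟩ := exists_smul_rankFourClass_add hij h
    rw [map_add, map_add, map_smul, map_smul, map_smul, map_smul, e₀, e₁]
  have h₂ := hidem' (rankFourClassOne k i j)
  rcases hr' with rfl | rfl
  · left
    rw [C_0, zero_smul] at h₀
    rw [C_0, zero_smul, add_zero] at h₁
    rw [h₁, map_smul, h₀, smul_zero] at h₂
    exact hext _ _ h₀ (h₁.trans h₂.symm)
  · right
    rw [C_1, one_smul] at h₀
    rw [C_1, one_smul] at h₁
    rw [h₁, map_add, map_smul, h₀, h₁, add_eq_right] at h₂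
    exact hext _ _ h₀ (by rw [h₁, h₂, zero_add]; rfl)

theorem rankFourClassOne_representative :
    @Eq (rankFour k i j).carrier ((X j ^ 2 : MvPolynomial (Fin d) k) • rankFourBasis k i j 1 +
      (X i : MvPolynomial (Fin d) k) • rankFourBasis k i j 2) ![0, 1 * X j ^ 2, 1 * X i, 0] := by
  rw [rankFourBasis_apply k i j 1, rankFourBasis_apply k i j 2]
  change (X j ^ 2 : MvPolynomial (Fin d) k) • (Pi.single 1 1 : Fin 4 → MvPolynomial (Fin d) k) +
    (X i : MvPolynomial (Fin d) k) • (Pi.single 2 1 : Fin 4 → MvPolynomial (Fin d) k) =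
    ![0, 1 * X j ^ 2, 1 * X i, 0]
  ext n : 1
  fin_cases n <;> simp

theorem rankFour_bracket_condition :
    signTwist (stdGrading k d) 1 (X j ^ 2) * (X i * X j) +
      signTwist (stdGrading k d) 1 (X i) * X j ^ 3 = 0 := by
  rw [map_pow, signTwist_one_X, signTwist_one_X]
  ring

theorem homologyClass_eq_rankFourClassOne (v : (rankFour k i j).carrier)
    (hv : (rankFour k i j).d v = 0) (h : v = ![0, 1 * X j ^ 2, 1 * X i, 0]) :
    (rankFour k i j).homologyClass v hv = rankFourClassOne k i j := by
  subst h
  rfl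

/-- The first three basis elements serve as `u`, `v₁`, `v₂`; the module is built to contain this
bracket. -/
theorem rankFourClassOne_mem_bracket :
    rankFourClassOne k i j ∈
      (rankFour k i j).bracket (X i * X j) (X j ^ 3) (X j ^ 2) (X i) := by
  have h := DGMod.homologyClass_mem_bracket rankFour_bracket_condition
    (rankFour_d_basis_zero k i j) (rankFour_d_basis_one k i j) (rankFour_d_basis_two k i j)
  rwa [homologyClass_eq_rankFourClassOne _ _ rankFourClassOne_representative] at h

/-- Otherwise some relation would have coefficient `X j ^ 2 * b + X i * b' - 1` at the second
generator. In every relation that coefficient is a multiple of `X j ^ 2`, so evaluation at the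
origin gives `-1 = 0`. -/
theorem rankFourClassOne_ne (hij : i ≠ j) (α β : (rankFour k i j).homology.carrier) :
    rankFourClassOne k i j ≠
      (X j ^ 2 : MvPolynomial (Fin d) k) • α + (X i : MvPolynomial (Fin d) k) • β := by
  obtain ⟨a, b, rfl⟩ := exists_smul_rankFourClass_add hij α
  obtain ⟨a', b', rfl⟩ := exists_smul_rankFourClass_add hij β
  intro h
  have h0 : (X j ^ 2 * a + X i * a') • rankFourClassZero k i j +
      (X j ^ 2 * b + X i * b' - 1) • rankFourClassOne k i j = 0 := by
    rw [sub_smul, one_smul, add_smul, add_smul, mul_smul, mul_smul, mul_smul, mul_smul]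
    nth_rw 3 [h]
    simp only [smul_add]
    abel
  obtain ⟨_, _, γ, -, e⟩ := (smul_rankFourClass_add_eq_zero_iff _ _).1 h0
  have := congrArg (eval (fun _ => (0 : k))) e
  simp at this

theorem rankFour_isEmpty_iso_tot (hij : i ≠ j) (Y : CochainComplex (GrMod (stdGrading k d)) ℤ) :
    IsEmpty ((DGMod.quasiIso (stdGrading k d)).Q.obj (rankFour k i j) ≅
      (DGMod.quasiIso (stdGrading k d)).Q.obj ((tot (stdGrading k d)).obj Y)) :=
  DGMod.isEmpty_iso_tot (rankFour_idempotentsTrivial hij) rankFour_homology_nontrivial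
    rankFour_bracket_condition rankFourClassOne_mem_bracket (rankFourClassOne_ne hij) Y

/-! ### The minimal free resolution -/

variable (k i j) in
/-- The relations between the generators of the homology of `rankFour`. -/
def rankFourRelations : GrMod.free (stdGrading k d) ![2, 3, 7] ⟶
    GrMod.free (stdGrading k d) ![0, 5] :=
  GrMod.freeHom _ ![![X i * X j, 0], ![X j ^ 3, 0], ![X i ^ 7, X j ^ 2]] (by
    have h0 : ∀ n, (0 : MvPolynomial (Fin d) k) ∈ stdGrading k d n := fun n => Submodule.zero_mem _
    have h1 : (X i * X j : MvPolynomial (Fin d) k) ∈ stdGrading k d 2 := by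
      simpa using X_mul_X_pow_mem_stdGrading (k := k) i j 1
    exact fun l => match l with
    | 0 => fun n => match n with
      | 0 => h1
      | 1 => h0 _
    | 1 => fun n => match n with
      | 0 => X_pow_mem_stdGrading j 3
      | 1 => h0 _
    | 2 => fun n => match n with
      | 0 => X_pow_mem_stdGrading i 7
      | 1 => X_pow_mem_stdGrading j 2)

variable (k i j) in
/-- The syzygy of the relations between the generators of the homology of `rankFour`. -/
def rankFourSyzygy : GrMod.free (stdGrading k d) ![4] ⟶
    GrMod.free (stdGrading k d) ![2, 3, 7] :=
  GrMod.freeHom _ ![![X j ^ 2, -X i, 0]] (by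
    exact fun l => match l with
    | 0 => fun n => match n with
      | 0 => X_pow_mem_stdGrading j 2
      | 1 => Submodule.neg_mem _ (X_mem_stdGrading i)
      | 2 => Submodule.zero_mem _)

theorem rankFourRelations_apply (v : Fin 3 → MvPolynomial (Fin d) k) :
    (rankFourRelations k i j).toLin v =
      ![v 0 * (X i * X j) + v 1 * X j ^ 3 + v 2 * X i ^ 7, v 2 * X j ^ 2] := by
  rw [rankFourRelations, GrMod.freeHom_apply, Fin.sum_univ_three]
  ext n : 1
  fin_cases n <;> simp

theorem rankFourSyzygy_apply (v : Fin 1 → MvPolynomial (Fin d) k) :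
    (rankFourSyzygy k i j).toLin v = ![v 0 * X j ^ 2, -(v 0 * X i), 0] := by
  rw [rankFourSyzygy, GrMod.freeHom_apply, Fin.sum_univ_one]
  ext n : 1
  fin_cases n <;> simp

theorem exact_rankFourRelations_rankFourCover :
    Function.Exact (rankFourRelations k i j).toLin (rankFourCover k i j).toLin := by
  intro v
  change Fin 2 → MvPolynomial (Fin d) k at v
  rw [rankFourCover_apply, smul_rankFourClass_add_eq_zero_iff]
  constructor
  · rintro ⟨α, β, γ, e₀, e₁⟩
    refine ⟨![α, β, γ], ?_⟩
    rw [rankFourRelations_apply]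
    ext n : 1
    fin_cases n
    · exact e₀.symm
    · exact e₁.symm
  · rintro ⟨w, rfl⟩
    rw [rankFourRelations_apply]
    exact ⟨w 0, w 1, w 2, rfl, rfl⟩

/-- The third relation is the only one involving the second generator, so its coefficient must
vanish; the first two then satisfy only the syzygy of `X i * X j` and `X j ^ 3`, obtained by
cancelling `X j`. -/
theorem exact_rankFourSyzygy_rankFourRelations (hij : i ≠ j) :
    Function.Exact (rankFourSyzygy k i j).toLin (rankFourRelations k i j).toLin := by
  intro v
  change Fin 3 → MvPolynomial (Fin d) k at v
  rw [rankFourRelations_apply]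
  constructor
  · intro h
    have e₁ : v 2 * X j ^ 2 = 0 := congrFun h 1
    have e₀ : v 0 * (X i * X j) + v 1 * X j ^ 3 + v 2 * X i ^ 7 = 0 := congrFun h 0
    have h₂ := (mul_eq_zero.1 e₁).resolve_right (pow_ne_zero _ (X_ne_zero j))
    have e : v 0 * X i = -v 1 * X j ^ 2 := by
      refine mul_right_cancel₀ (X_ne_zero j) ?_
      rw [h₂] at e₀
      linear_combination e₀
    obtain ⟨g, hg₀, hg₁⟩ := exists_eq_mul_of_mul_X_eq_mul_X_pow hij e
    refine ⟨![g], ?_⟩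
    rw [rankFourSyzygy_apply]
    ext n : 1
    fin_cases n
    · exact hg₀.symm
    · exact neg_eq_iff_eq_neg.2 hg₁.symm
    · exact h₂.symm
  · rintro ⟨w, rfl⟩
    rw [rankFourSyzygy_apply]
    change _ = (0 : Fin 2 → MvPolynomial (Fin d) k)
    ext n : 1
    fin_cases n <;> simp
    ring

theorem range_rankFourRelations_le : LinearMap.range (rankFourRelations k i j).toLin ≤
    GrMod.irrelevantIdeal (stdGrading k d) •
      (⊤ : Submodule _ (GrMod.free (stdGrading k d) ![0, 5]).carrier) := by
  have hi := X_mem_irrelevantIdeal (k := k) i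
  have hj := X_mem_irrelevantIdeal (k := k) j
  unfold rankFourRelations
  refine GrMod.range_freeHom_le _ _ fun l n => ?_
  fin_cases l <;> fin_cases n
  · exact Ideal.mul_mem_right _ _ hi
  · exact Submodule.zero_mem _
  · exact Ideal.pow_mem_of_mem _ hj 3 (by norm_num)
  · exact Submodule.zero_mem _
  · exact Ideal.pow_mem_of_mem _ hi 7 (by norm_num)
  · exact Ideal.pow_mem_of_mem _ hj 2 (by norm_num)

theorem range_rankFourSyzygy_le : LinearMap.range (rankFourSyzygy k i j).toLin ≤
    GrMod.irrelevantIdeal (stdGrading k d) •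
      (⊤ : Submodule _ (GrMod.free (stdGrading k d) ![2, 3, 7]).carrier) := by
  have hi := X_mem_irrelevantIdeal (k := k) i
  have hj := X_mem_irrelevantIdeal (k := k) j
  unfold rankFourSyzygy
  refine GrMod.range_freeHom_le _ _ fun l n => ?_
  fin_cases l; fin_cases n
  · exact Ideal.pow_mem_of_mem _ hj 2 (by norm_num)
  · exact Submodule.neg_mem _ hi
  · exact Submodule.zero_mem _

variable (k d) in
/-- The modules of the minimal free resolution of the homology of `rankFour`. -/
def rankFourF : ℕ → GrMod (stdGrading k d)
  | 0 => GrMod.free _ ![0, 5]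
  | 1 => GrMod.free _ ![2, 3, 7]
  | 2 => GrMod.free _ ![4]
  | _ + 3 => GrMod.free _ ![]

variable (k i j) in
/-- The differentials of the minimal free resolution of the homology of `rankFour`. -/
def rankFourResolutionD : ∀ n, rankFourF k d (n + 1) ⟶ rankFourF k d n
  | 0 => rankFourRelations k i j
  | 1 => rankFourSyzygy k i j
  | _ + 2 => 0

instance (n : ℕ) : Subsingleton (rankFourF k d (n + 3)).carrier :=
  inferInstanceAs (Subsingleton (Fin 0 → MvPolynomial (Fin d) k))

variable (k) in
/-- The minimal free resolution of the homology of `rankFour`. -/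
def rankFourResolution (hij : i ≠ j) :
    (rankFour k i j).homology.MinimalFreeResolution where
  F := rankFourF k d
  free
    | 0 => GrMod.isGradedFree_free _ _
    | 1 => GrMod.isGradedFree_free _ _
    | 2 => GrMod.isGradedFree_free _ _
    | _ + 3 => GrMod.isGradedFree_free _ _
  d := rankFourResolutionD k i j
  ε := rankFourCover k i j
  ε_surjective := rankFourCover_surjective hij
  exact_zero := exact_rankFourRelations_rankFourCover
  exact_succ
    | 0 => exact_rankFourSyzygy_rankFourRelations hij
    | 1 => by
      intro v
      refine ⟨fun h => ⟨0, ?_⟩, ?_⟩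
      · change Fin 1 → MvPolynomial (Fin d) k at v
        change (rankFourSyzygy k i j).toLin v = 0 at h
        rw [rankFourSyzygy_apply] at h
        have h₀ := (mul_eq_zero.1 (congrFun h 0)).resolve_right (pow_ne_zero _ (X_ne_zero j))
        rw [map_zero]
        change (0 : Fin 1 → MvPolynomial (Fin d) k) = v
        ext n : 1
        fin_cases n
        exact h₀.symm
      · rintro ⟨w, rfl⟩
        exact map_zero (rankFourSyzygy k i j).toLin
    | n + 2 => fun v => ⟨fun _ => ⟨0, Subsingleton.elim _ _⟩, fun _ => rfl⟩
  minimal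
    | 0 => range_rankFourRelations_le
    | 1 => range_rankFourSyzygy_le
    | n + 2 => by
      rintro _ ⟨v, rfl⟩
      exact Submodule.zero_mem _

theorem bettiSum_rankFourResolution (hij : i ≠ j) : (rankFourResolution k hij).bettiSum = 6 := by
  have h0 : Module.rank (MvPolynomial (Fin d) k) (rankFourF k d 0).carrier = (2 : ℕ) :=
    GrMod.rank_free _ _
  have h1 : Module.rank (MvPolynomial (Fin d) k) (rankFourF k d 1).carrier = (3 : ℕ) :=
    GrMod.rank_free _ _
  have h2 : Module.rank (MvPolynomial (Fin d) k) (rankFourF k d 2).carrier = (1 : ℕ) :=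
    GrMod.rank_free _ _
  have h3 : ∀ n, Module.rank (MvPolynomial (Fin d) k) (rankFourF k d (n + 3)).carrier = 0 :=
    fun n => rank_subsingleton' _ _
  change Cardinal.sum (fun n => Module.rank (MvPolynomial (Fin d) k) (rankFourF k d n).carrier) = 6
  rw [Cardinal.sum_nat_eq_add_sum_succ, Cardinal.sum_nat_eq_add_sum_succ,
    Cardinal.sum_nat_eq_add_sum_succ]
  simp only [h0, h1, h2, Nat.reduceAdd, h3, Cardinal.sum_const]
  norm_num

end RankFourHomology

theorem mainTheorem1 (k : Type u) [Field k] (d : ℕ) (hd : 2 ≤ d) :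
    ¬ (derivedTot (stdGrading k d)).EssSurj ∧
    ∃ (M : DGMod (stdGrading k d)) (e : Module.Basis (Fin 4) (MvPolynomial (Fin d) k) M.carrier)
      (x₁ x₂ : MvPolynomial (Fin d) k),
      x₁ = MvPolynomial.X ⟨0, by omega⟩ ∧ x₂ = MvPolynomial.X ⟨1, by omega⟩ ∧
      -- the explicit semifree DG module of rank four
      e 0 ∈ M.deg 0 ∧ e 1 ∈ M.deg 3 ∧ e 2 ∈ M.deg 4 ∧ e 3 ∈ M.deg 8 ∧
      M.d (e 0) = 0 ∧
      M.d (e 1) = (x₁ * x₂) • e 0 ∧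
      M.d (e 2) = x₂ ^ 3 • e 0 ∧
      M.d (e 3) = x₁ ^ 7 • e 0 + x₂ ^ 4 • e 1 + (x₁ * x₂ ^ 2) • e 2 ∧
      M.IsSemibasis e ∧
      -- its homology is indecomposable, with total Betti numbers adding up to six
      M.homology.IsIndecomposable ∧
      Nonempty M.homology.MinimalFreeResolution ∧
      (∀ R : M.homology.MinimalFreeResolution, R.bettiSum = 6) ∧
      -- it is not quasiisomorphic to a totaling, and lies outside the essential image of `Tot`
      (∀ X : CochainComplex (GrMod (stdGrading k d)) ℤ,
        ¬ DGMod.QuasiIsomorphic M ((tot (stdGrading k d)).obj X)) ∧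
      ¬ (derivedTot (stdGrading k d)).essImage ((DGMod.quasiIso (stdGrading k d)).Q.obj M) := by
  have hij : (⟨0, by omega⟩ : Fin d) ≠ ⟨1, by omega⟩ := by simp
  have hess := not_mem_essImage_derivedTot (rankFour_isEmpty_iso_tot (k := k) hij)
  refine ⟨fun h => hess (h.mem_essImage _), rankFour k ⟨0, by omega⟩ ⟨1, by omega⟩,
    rankFourBasis k _ _, _, _, rfl, rfl, rankFourBasis_mem_deg k _ _ 0,
    rankFourBasis_mem_deg k _ _ 1, rankFourBasis_mem_deg k _ _ 2, rankFourBasis_mem_deg k _ _ 3,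
    rankFour_d_basis_zero k _ _, rankFour_d_basis_one k _ _, rankFour_d_basis_two k _ _,
    rankFour_d_basis_three k _ _, rankFour_isSemibasis k _ _,
    (rankFour_idempotentsTrivial hij).isIndecomposable rankFour_homology_nontrivial,
    ⟨rankFourResolution k hij⟩, fun R => ?_, fun X h => ?_, hess⟩
  -- Betti numbers are independent of the resolution, so the explicit one decides for every `R`.
  · rw [R.bettiSum_eq irrelevantIdeal_stdGrading_ne_top (rankFourResolution k hij),
      bettiSum_rankFourResolution]
  · exact (rankFour_isEmpty_iso_tot hij X).false h.nonempty_iso.some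

end
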